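/- A relational structure $\mathcal A=(A,r_1,\dots,r_n)$ is a countable set $A$ with finitely many relations of finite arities; equality is always counted among the definable relations. An embedding $\iota:A\to A$ is a map that preserves and reflects all relations (and equality, so it is injective); $\mathrm{Emb}$ denotes the set of all embeddings of $\mathcal A$ into itself. * $\mathcal A$ is *$\omega$-well structured* if the following quasi order on functions $\ell:B\to\mathbb N$, with $B\subseteq A$ finite, is a well quasi order: $(\ell:B\to\mathbb N)\rightsquigarrow(\ell':B'\to\mathbb N)$ iff there is $\iota\in\mathrm{Emb}$ with $\iota(B)\subseteq B'$ and $\ell(b)\le\ell'(\iota(b))$ for all $b\in B$. * $\mathcal A$ is *well ordered* if some well order of $A$ is expressible as a Boolean combination of the relations of $\mathcal A$. * For finite $B\subseteq A$, a *local embedding* of $B$ is the restriction $\iota|_B$ of some $\iota\in\mathrm{Emb}$. A *presentation* for finite $B,B'\subseteq A$ is a finite set $F$ of pairs $(\pi,\pi')$ of local embeddings of $B$ and $B'$, respectively, such that the set of all such pairs equals $\{(\kappa\circ\pi,\kappa\circ\pi') : \kappa\in\mathrm{Emb},\ (\pi,\pi')\in F\}$. * $\mathcal A$ is *computable* if the elements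 of $A$ are finitely represented (with decidable equality) so that (1) given a finite $B\subseteq A$ and $\pi:B\to A$, one can decide whether $\pi$ is a local embedding of $B$; and (2) given finite $B,B'\subseteq A$, one can compute a presentation for $B,B'$. * A field $\mathbb K$ is *computable* if its elements are finitely represented (with decidable equality) so that the field operations are computable. * An ideal $I$ of the polynomial ring $\mathbb K[A]$ with the elements of $A$ as variables is *equivariant* if it is closed under renaming of variables along every $\iota\in\mathrm{Emb}$; the equivariant ideal generated by a set of polynomials is the least equivariant ideal including it. **Theorem.** Let $\mathbb K$ be a computable field and let $\mathcal A$ be an $\omega$-well structured, well ordered and computable relational structure. Then the following problem is decidable: given a polynomial $f\in\mathbb K[A]$ and a finite set $G\subseteq\mathbb K[A]$ (polynomials being given as finite sums of terms, through the representations of $\mathbb K$ and $A$), does $f$ belong to the equivariant ideal generated by $G$? -/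

import Mathlib

open FirstOrder

/-- `A^(Y)`: finite induced substructures of `A` labelled by elements of `Y`, that is, functions
`ℓ : B → Y` with `B` a finite subset of `A`. -/
def LabelledAge (A Y : Type*) : Type _ := Σ B : Finset A, (B → Y)

/-- The quasi order on labelled finite substructures determined by `Y`: some embedding of the whole
structure `A` into itself maps `B` into `B'` and does not decrease labels. -/
def LabelledAge.Le (L : Language) {A Y : Type*} [L.Structure A] [LE Y]
    (x y : LabelledAge A Y) : Prop :=
  ∃ ι : A ↪[L] A, ∃ h : ∀ b ∈ x.1, ι b ∈ y.1, ∀ b : x.1, x.2 b ≤ y.2 ⟨ι b, h b b.2⟩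

/-- `A` is `ω`-well structured: `(ℕ, ≤)` determines a well quasi order on the finite induced
substructures of `A` labelled by natural numbers. -/
def OmegaWellStructured (L : Language) (A : Type*) [L.Structure A] : Prop :=
  WellQuasiOrdered (LabelledAge.Le L : LabelledAge A ℕ → LabelledAge A ℕ → Prop)

/-- `A` is well ordered: some (strict) well order of `A` is definable, that is, expressible as a
Boolean combination of the relations of `A` (and equality). -/
def DefinablyWellOrdered (L : Language) (A : Type*) [L.Structure A] : Prop :=
  ∃ φ : L.Formula (Fin 2), φ.IsQF ∧ IsWellOrder A (fun a b => φ.Realize ![a, b])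

/-- The local embeddings of a finite set `B`, i.e. the restrictions to `B` of embeddings `A → A`.
A finite set is given by a list `B` of its elements and a function `B → A` by the list of its values
along `B`. -/
def localEmbeddings (L : Language) {A : Type*} [L.Structure A] (B : List A) : Set (List A) :=
  {v | ∃ ι : A ↪[L] A, v = B.map ι}

/-- A finite set `F` of pairs of local embeddings of `B` and `B'` is a presentation of the set of
all such pairs if the latter consists precisely of the pairs `(κ ∘ π, κ ∘ π')` with `(π, π') ∈ F`
and `κ` an embedding `A → A`. -/
def IsPresentation (L : Language) {A : Type*} [L.Structure A] (B B' : List A)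
    (F : List (List A × List A)) : Prop :=
  (∀ q ∈ F, q ∈ localEmbeddings L B ×ˢ localEmbeddings L B') ∧
  {p : List A × List A | ∃ κ : A ↪[L] A, ∃ q ∈ F, p = (q.1.map κ, q.2.map κ)} =
    localEmbeddings L B ×ˢ localEmbeddings L B'

/-- Computability of a domain of variables whose elements are finitely represented (the
representation being the `Primcodable` instance). -/
structure ComputableDomain (L : Language) (A : Type*) [L.Structure A] [Primcodable A] : Prop where
  /-- Given a finite `B` and `π : B → A`, one can decide if `π` is a local embedding. -/
  decide_local : ComputablePred fun p : List A × List A => p.2 ∈ localEmbeddings L p.1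
  /-- Given finite `B` and `B'`, one can compute a presentation of the set of pairs of local
  embeddings of `B` and `B'`. -/
  compute_presentation : ∃ P : List A → List A → List (List A × List A),
    Computable₂ P ∧ ∀ B B', IsPresentation L B B' (P B B')

/-- A computable field: elements are finitely represented (by the `Primcodable` instance, for which
equality is decidable) and the field operations are computable. -/
structure ComputableField (K : Type*) [Field K] [Primcodable K] : Prop where
  add : Computable₂ fun x y : K => x + y
  neg : Computable fun x : K => -x
  mul : Computable₂ fun x y : K => x * y
  inv : Computable fun x : K => x⁻¹

/-- Finite representations of polynomials: lists of terms `r · a₁ ^ n₁ ⋯ aₘ ^ nₘ`, each given by its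
coefficient `r` and the list of the pairs `(aᵢ, nᵢ)`. -/
abbrev PolyCode (K A : Type*) : Type _ := List (K × List (A × ℕ))

/-- The polynomial represented by a code. -/
noncomputable def PolyCode.toPoly {K A : Type*} [CommSemiring K] (c : PolyCode K A) :
    MvPolynomial A K :=
  (c.map fun t => MvPolynomial.C t.1 * (t.2.map fun v => MvPolynomial.X v.1 ^ v.2).prod).sum

/-- An ideal is equivariant if it is closed under renaming of variables along embeddings `A → A`. -/
def IsEquivariantIdeal (L : Language) {K A : Type*} [CommRing K] [L.Structure A]
    (I : Ideal (MvPolynomial A K)) : Prop :=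
  ∀ ι : A ↪[L] A, ∀ f ∈ I, MvPolynomial.rename ι f ∈ I

/-- The equivariant ideal generated by `S`: the least equivariant ideal that includes `S`. -/
noncomputable def equivariantSpan (L : Language) {K A : Type*} [CommRing K] [L.Structure A]
    (S : Set (MvPolynomial A K)) : Ideal (MvPolynomial A K) :=
  sInf {I | IsEquivariantIdeal L I ∧ S ⊆ I}

/-! Membership and non-membership are both shown to be semi-decidable, so Post's theorem gives
decidability. An element of the equivariant ideal generated by `G` is a finite sum of terms times
renamed copies of elements of `G`. Since local embeddings are decidable, so is the question whether
one code is a renamed copy of another, and membership is found by search.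

Non-membership is certified by an equivariant Gröbner basis. Monomials are ordered lexicographically
along the definable well order of the variables, largest variable first. This order is well founded,
and it is preserved by renaming because embeddings preserve quantifier-free formulas. By `ω`-well
structuredness, divisibility up to embeddings is a well quasi order on monomials, so every
equivariant ideal has a finite set `H` whose orbits form a Gröbner basis (`exists_isGroebner`).
Buchberger's criterion for the possibly infinite set of copies need only be checked on the finitely
many pairs in the presentations, as every other pair is the image of one of these under a single
embedding (`isBuchberger_orbit`).

A certificate for `f` (`notMem_equivariantSpan_iff`) consists of some `H` that passes the criterion
and generates at least `G`, and some `g`, congruent to `f` modulo the ideal of `H`, whose leading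
monomial no leading monomial of a copy divides. `H` need not lie in the ideal of `G`, since
non-membership in a larger ideal suffices. No completion algorithm is run: only the existence of a
certificate is used, and all reductions in it are again found by search. The well order itself is
decidable because finitely many pairs generate it under embeddings
(`computablePred_of_embedding_invariant`). -/

/-! ### Computable operations on lists -/

theorem Computable.list_foldl {α β σ : Type*} [Primcodable α] [Primcodable β] [Primcodable σ]
    {f : α → List β} {g : α → σ} {h : α → σ × β → σ}
    (hf : Computable f) (hg : Computable g) (hh : Computable₂ h) :
    Computable fun a => (f a).foldl (fun s b => h a (s, b)) (g a) := by
  have key : Computable fun a => Nat.rec (motive := fun _ => σ) (g a)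
      (fun n s => Option.casesOn (f a)[n]? s fun b => h a (s, b)) (f a).length := by
    refine Computable.nat_rec (h := fun a (p : ℕ × σ) =>
      (Option.casesOn (f a)[p.1]? p.2 fun b => h a (p.2, b) : σ))
      (Computable.list_length.comp hf) hg ?_
    refine Computable.option_casesOn (g := fun (q : α × (ℕ × σ)) b => h q.1 (q.2.2, b))
      (Computable.list_getElem?.comp (hf.comp .fst) (Computable.fst.comp .snd))
      (Computable.snd.comp .snd) ?_
    exact hh.comp (Computable.fst.comp .fst)
      ((Computable.snd.comp (Computable.snd.comp .fst)).pair .snd)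
  refine key.of_eq fun a => ?_
  -- After `n` rounds the recursion has folded the prefix of length `n`; an index out of range would
  -- leave the state unchanged.
  suffices H : ∀ n, Nat.rec (motive := fun _ => σ) (g a)
      (fun n s => Option.casesOn (f a)[n]? s fun b => h a (s, b)) n
      = ((f a).take n).foldl (fun s b => h a (s, b)) (g a) by
    simpa using H (f a).length
  intro n
  induction n with
  | zero => simp
  | succ n ih =>
    rw [List.take_add_one, List.foldl_append, ← ih]
    rcases hx : (f a)[n]? with _ | b <;> simp [hx]

theorem Computable.list_foldr {α β σ : Type*} [Primcodable α] [Primcodable β] [Primcodable σ]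
    {f : α → List β} {g : α → σ} {h : α → β × σ → σ}
    (hf : Computable f) (hg : Computable g) (hh : Computable₂ h) :
    Computable fun a => (f a).foldr (fun b s => h a (b, s)) (g a) := by
  refine (Computable.list_foldl (h := fun a (p : σ × β) => h a (p.2, p.1))
    (Computable.list_reverse.comp hf) hg ?_).of_eq fun a => by simp
  exact hh.comp .fst ((Computable.snd.comp .snd).pair (Computable.fst.comp .snd))

theorem Computable.list_map {α β σ : Type*} [Primcodable α] [Primcodable β] [Primcodable σ]
    {f : α → List β} {g : α → β → σ} (hf : Computable f) (hg : Computable₂ g) :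
    Computable fun a => (f a).map (g a) := by
  refine (Computable.list_foldr (g := fun _ => []) (h := fun a (p : β × List σ) => g a p.1 :: p.2)
    hf (.const _) ?_).of_eq fun a => ?_
  · exact Computable.list_cons.comp (hg.comp .fst (Computable.fst.comp .snd))
      (Computable.snd.comp .snd)
  · induction f a <;> simp_all

theorem Computable.list_flatten {α : Type*} [Primcodable α] :
    Computable (List.flatten : List (List α) → List α) := Primrec.list_flatten.to_comp

/-! ### Decidable predicates -/

namespace ComputablePred

variable {α β : Type*} [Primcodable α] [Primcodable β]

theorem exists_bool {p : α → Prop} (hp : ComputablePred p) :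
    ∃ f : α → Bool, Computable f ∧ ∀ a, p a ↔ f a = true := by
  obtain ⟨f, hf, rfl⟩ := ComputablePred.computable_iff.1 hp
  exact ⟨f, hf, fun a => Iff.rfl⟩

theorem of_bool {p : α → Prop} {f : α → Bool} (hf : Computable f) (h : ∀ a, p a ↔ f a = true) :
    ComputablePred p :=
  ComputablePred.computable_iff.2 ⟨f, hf, funext fun a => propext (h a)⟩

theorem comp {p : β → Prop} {f : α → β} (hp : ComputablePred p) (hf : Computable f) :
    ComputablePred fun a => p (f a) := by
  obtain ⟨g, hg, h⟩ := hp.exists_bool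
  exact of_bool (hg.comp hf) fun a => h _

theorem and {p q : α → Prop} (hp : ComputablePred p) (hq : ComputablePred q) :
    ComputablePred fun a => p a ∧ q a := by
  obtain ⟨f, hf, h⟩ := hp.exists_bool
  obtain ⟨g, hg, h'⟩ := hq.exists_bool
  exact of_bool (Primrec.and.to_comp.comp hf hg) fun a => by simp [h, h']

theorem or {p q : α → Prop} (hp : ComputablePred p) (hq : ComputablePred q) :
    ComputablePred fun a => p a ∨ q a := by
  obtain ⟨f, hf, h⟩ := hp.exists_bool
  obtain ⟨g, hg, h'⟩ := hq.exists_bool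
  exact of_bool (Primrec.or.to_comp.comp hf hg) fun a => by simp [h, h']

theorem imp {p q : α → Prop} (hp : ComputablePred p) (hq : ComputablePred q) :
    ComputablePred fun a => p a → q a :=
  (hp.not.or hq).of_eq fun a => by tauto

theorem exists_mem {f : α → List β} {p : α → β → Prop} (hf : Computable f)
    (hp : ComputablePred fun q : α × β => p q.1 q.2) :
    ComputablePred fun a => ∃ b ∈ f a, p a b := by
  obtain ⟨g, hg, h⟩ := hp.exists_bool
  refine of_bool (Computable.list_foldr (g := fun _ => false)
    (h := fun a (q : β × Bool) => g (a, q.1) || q.2) hf (.const _) ?_) fun a => ?_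
  · exact Primrec.or.to_comp.comp
      (hg.comp (Computable.fst.pair (Computable.fst.comp .snd))) (Computable.snd.comp .snd)
  · have h' : ∀ b, p a b ↔ g (a, b) = true := fun b => h (a, b)
    simp only [h']
    induction f a with
    | nil => simp
    | cons x l ih => simp [← ih]

theorem forall_mem {f : α → List β} {p : α → β → Prop} (hf : Computable f)
    (hp : ComputablePred fun q : α × β => p q.1 q.2) :
    ComputablePred fun a => ∀ b ∈ f a, p a b :=
  (exists_mem (p := fun a b => ¬p a b) hf hp.not).not.of_eq fun a => by push Not; rfl

theorem eq {f g : α → β} (hf : Computable f) (hg : Computable g) :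
    ComputablePred fun a => f a = g a := by
  classical
  exact comp (p := fun q : β × β => q.1 = q.2) (PrimrecPred.computablePred (Primrec.eq (α := β)))
    (hf.pair hg)

theorem nat_lt {f g : α → ℕ} (hf : Computable f) (hg : Computable g) :
    ComputablePred fun a => f a < g a :=
  comp (p := fun q : ℕ × ℕ => q.1 < q.2) (PrimrecPred.computablePred Primrec.nat_lt) (hf.pair hg)

theorem nat_le {f g : α → ℕ} (hf : Computable f) (hg : Computable g) :
    ComputablePred fun a => f a ≤ g a :=
  comp (p := fun q : ℕ × ℕ => q.1 ≤ q.2) (PrimrecPred.computablePred Primrec.nat_le) (hf.pair hg)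

end ComputablePred

theorem Computable.ite' {α σ : Type*} [Primcodable α] [Primcodable σ] {p : α → Prop}
    [DecidablePred p] {f g : α → σ} (hp : ComputablePred p) (hf : Computable f)
    (hg : Computable g) : Computable fun a => if p a then f a else g a := by
  obtain ⟨b, hb, h⟩ := hp.exists_bool
  refine (Computable.cond hb hf hg).of_eq fun a => ?_
  by_cases hpa : p a
  · simp [hpa, (h a).1 hpa]
  · have := mt (h a).2 hpa
    simp [hpa, this]

/-! ### Semi-decidable predicates -/

/-- Projections of decidable predicates. -/
def SigmaOne {α : Type*} [Primcodable α] (p : α → Prop) : Prop :=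
  ∃ R : α × ℕ → Prop, ComputablePred R ∧ ∀ a, p a ↔ ∃ n, R (a, n)

theorem ComputablePred.sigmaOne {α : Type*} [Primcodable α] {p : α → Prop}
    (hp : ComputablePred p) : SigmaOne p :=
  ⟨fun q => p q.1, hp.comp .fst, fun a => by simp⟩

namespace SigmaOne

variable {α β : Type*} [Primcodable α] [Primcodable β]

theorem of_eq {p q : α → Prop} (hp : SigmaOne p) (h : ∀ a, p a ↔ q a) : SigmaOne q := by
  obtain ⟨R, hR, h'⟩ := hp
  exact ⟨R, hR, fun a => (h a).symm.trans (h' a)⟩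

theorem comp {p : β → Prop} {f : α → β} (hp : SigmaOne p) (hf : Computable f) :
    SigmaOne fun a => p (f a) := by
  obtain ⟨R, hR, h⟩ := hp
  exact ⟨fun q => R (f q.1, q.2), hR.comp ((hf.comp .fst).pair .snd), fun a => h _⟩

theorem ex {p : α → β → Prop} (hp : SigmaOne fun q : α × β => p q.1 q.2) :
    SigmaOne fun a => ∃ b, p a b := by
  obtain ⟨R, hR, h⟩ := hp
  obtain ⟨g, hg, h'⟩ := hR.exists_bool
  have hc : Computable fun q : α × ℕ =>
      (Option.casesOn (Encodable.decode (α := β) q.2.unpair.1) false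
        fun b => g ((q.1, b), q.2.unpair.2) : Bool) := by
    refine Computable.option_casesOn
      (g := fun (q : α × ℕ) (b : β) => g ((q.1, b), q.2.unpair.2)) ?_ (.const _) ?_
    · exact Computable.decode.comp (Computable.fst.comp (Computable.unpair.comp .snd))
    · exact hg.comp (((Computable.fst.comp .fst).pair .snd).pair
        (Computable.snd.comp (Computable.unpair.comp (Computable.snd.comp .fst))))
  refine ⟨_, ComputablePred.of_bool hc fun a => Iff.rfl, fun a => ⟨?_, ?_⟩⟩
  · rintro ⟨b, hb⟩
    obtain ⟨n, hn⟩ := (h (a, b)).1 hb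
    -- One search parameter carries both the code of the witness and its own search bound; numbers
    -- that decode to nothing are rejected.
    exact ⟨Nat.pair (Encodable.encode b) n, by simpa using (h' _).1 hn⟩
  · rintro ⟨n, hn⟩
    rcases hd : Encodable.decode (α := β) n.unpair.1 with _ | b
    · simp [hd] at hn
    · simp only [hd] at hn
      exact ⟨b, (h (a, b)).2 ⟨_, (h' _).2 hn⟩⟩

theorem and {p q : α → Prop} (hp : SigmaOne p) (hq : SigmaOne q) :
    SigmaOne fun a => p a ∧ q a := by
  obtain ⟨R, hR, h⟩ := hp
  obtain ⟨S, hS, h'⟩ := hq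
  have : SigmaOne fun a => ∃ n : ℕ × ℕ, R (a, n.1) ∧ S (a, n.2) := by
    refine SigmaOne.ex (ComputablePred.sigmaOne ?_)
    exact (hR.comp (Computable.fst.pair (Computable.fst.comp .snd))).and
      (hS.comp (Computable.fst.pair (Computable.snd.comp .snd)))
  refine this.of_eq fun a => ?_
  simp [h, h']

/-- Finitely many witnesses have a common bound `N`, so the unbounded search can be moved in front
of the bounded quantifier. -/
theorem forall_mem {f : α → List β} {p : α → β → Prop} (hf : Computable f)
    (hp : SigmaOne fun q : α × β => p q.1 q.2) : SigmaOne fun a => ∀ b ∈ f a, p a b := by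
  obtain ⟨R, hR, h⟩ := hp
  have : SigmaOne fun a => ∃ N : ℕ, ∀ b ∈ f a, ∃ n ∈ List.range N, R ((a, b), n) := by
    refine SigmaOne.ex (ComputablePred.sigmaOne ?_)
    refine ComputablePred.forall_mem (p := fun (q : α × ℕ) b =>
      ∃ n ∈ List.range q.2, R ((q.1, b), n)) (hf.comp .fst) ?_
    refine ComputablePred.exists_mem (f := fun q : (α × ℕ) × β => List.range q.1.2)
      (p := fun (q : (α × ℕ) × β) n => R ((q.1.1, q.2), n))
      (Primrec.list_range.to_comp.comp (Computable.snd.comp .fst)) ?_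
    exact hR.comp (((Computable.fst.comp (Computable.fst.comp .fst)).pair
      (Computable.snd.comp .fst)).pair .snd)
  refine this.of_eq fun a => ⟨?_, ?_⟩
  · rintro ⟨N, hN⟩ b hb
    obtain ⟨n, -, hn⟩ := hN b hb
    exact (h (a, b)).2 ⟨n, hn⟩
  · intro H
    have H' : ∀ b ∈ f a, ∃ n, R ((a, b), n) := fun b hb => (h (a, b)).1 (H b hb)
    clear H
    generalize f a = l at H'
    induction l with
    | nil => exact ⟨0, by simp⟩
    | cons x l ih =>
      obtain ⟨n, hn⟩ := H' x (by simp)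
      obtain ⟨N, hN⟩ := ih fun b hb => H' b (by simp [hb])
      refine ⟨max (n + 1) N, fun b hb => ?_⟩
      rcases List.mem_cons.1 hb with rfl | hb
      · exact ⟨n, by simp, hn⟩
      · obtain ⟨k, hk, hk'⟩ := hN b hb
        exact ⟨k, by simp at hk ⊢; omega, hk'⟩

theorem rePred {p : α → Prop} (hp : SigmaOne p) : REPred p := by
  obtain ⟨R, hR, h⟩ := hp
  obtain ⟨g, hg, h'⟩ := hR.exists_bool
  have : Partrec fun a => Nat.rfind fun n => Part.some (g (a, n)) :=
    Partrec.rfind (p := fun a n => Part.some (g (a, n))) hg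
  refine this.dom_re.of_eq fun a => ?_
  rw [h]
  refine Nat.rfind_dom'.trans ?_
  simp [h']

/-- Post's theorem. -/
theorem computablePred {p : α → Prop} (hp : SigmaOne p) (hn : SigmaOne fun a => ¬p a) :
    ComputablePred p :=
  ComputablePred.computable_iff_re_compl_re'.2 ⟨hp.rePred, hn.rePred⟩

end SigmaOne

/-! ### The monomial order -/

/-- The lexicographic order on monomials in which the largest variable is the most significant. -/
def monoLt {A : Type*} (r : A → A → Prop) (m n : A →₀ ℕ) : Prop :=
  ∃ a, (∀ b, r a b → m b = n b) ∧ m a < n a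

section monoLt

variable {A : Type*} {r : A → A → Prop} [IsWellOrder A r] {m n k : A →₀ ℕ}

/-- This is `Finsupp.Lex` for the reversed order of variables, whose well-foundedness rests on that
of `r`. -/
theorem monoLt_wf : WellFounded (monoLt r) := by
  have h : WellFounded (Finsupp.Lex (fun a b => r b a) ((· < ·) : ℕ → ℕ → Prop)) := by
    have : Std.Trichotomous (fun a b => r b a) := ⟨fun a b h h' =>
      Std.Trichotomous.trichotomous (r := r) a b h' h⟩
    exact Finsupp.Lex.wellFounded' (fun _ => Nat.not_lt_zero _) wellFounded_lt
      (IsWellFounded.wf (r := r))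
  exact h

theorem monoLt_trans (h : monoLt r m n) (h' : monoLt r n k) : monoLt r m k := by
  obtain ⟨a, ha, ha'⟩ := h
  obtain ⟨b, hb, hb'⟩ := h'
  rcases trichotomous_of r a b with hab | rfl | hab
  · exact ⟨b, fun c hc => (ha c (_root_.trans hab hc)).trans (hb c hc), by rwa [ha b hab]⟩
  · exact ⟨a, fun c hc => (ha c hc).trans (hb c hc), ha'.trans hb'⟩
  · exact ⟨a, fun c hc => (ha c hc).trans (hb c (_root_.trans hab hc)), by rwa [← hb a hab]⟩

omit [IsWellOrder A r] in
theorem monoLt_irrefl (m : A →₀ ℕ) : ¬monoLt r m m := fun ⟨_, _, h⟩ => lt_irrefl _ h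

/-- Only finitely many exponents differ; the largest variable among these decides. -/
theorem monoLt_or_of_ne (h : m ≠ n) : monoLt r m n ∨ monoLt r n m := by
  classical
  let _ := linearOrderOfSTO r
  have hne : ((m.support ∪ n.support).filter fun a => m a ≠ n a).Nonempty := by
    obtain ⟨a, ha⟩ := DFunLike.ne_iff.1 h
    refine ⟨a, ?_⟩
    simp only [Finset.mem_filter, Finset.mem_union, Finsupp.mem_support_iff]
    exact ⟨by by_contra! H; exact ha (H.1.trans H.2.symm), ha⟩
  obtain ⟨a, ha, hmax⟩ := Finset.exists_max_image _ id hne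
  have ha' := (Finset.mem_filter.1 ha).2
  have key : ∀ b, r a b → m b = n b := by
    intro b hb
    by_contra hne
    have hb' : b ∈ (m.support ∪ n.support).filter fun a => m a ≠ n a := by
      simp only [Finset.mem_filter, Finset.mem_union, Finsupp.mem_support_iff]
      exact ⟨by by_contra! H; exact hne (H.1.trans H.2.symm), hne⟩
    exact absurd (show a < b from hb) (not_lt.2 (hmax b hb'))
  rcases lt_or_gt_of_ne ha' with hlt | hlt
  · exact .inl ⟨a, key, hlt⟩
  · exact .inr ⟨a, fun b hb => (key b hb).symm, hlt⟩

omit [IsWellOrder A r] in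
theorem monoLt_add_left (h : monoLt r m n) (k : A →₀ ℕ) : monoLt r (k + m) (k + n) := by
  obtain ⟨a, ha, ha'⟩ := h
  exact ⟨a, fun b hb => by simp [ha b hb], by simpa using ha'⟩

-- Variables outside the range of `ι` have exponent 0 on both sides, so only renamed variables are
-- compared.
omit [IsWellOrder A r] in
theorem monoLt_mapDomain {ι : A → A} (hinj : Function.Injective ι)
    (hι : ∀ a b, r (ι a) (ι b) → r a b) (h : monoLt r m n) :
    monoLt r (m.mapDomain ι) (n.mapDomain ι) := by
  obtain ⟨a, ha, ha'⟩ := h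
  refine ⟨ι a, fun b hb => ?_, by simpa [Finsupp.mapDomain_apply hinj] using ha'⟩
  by_cases hb' : b ∈ Set.range ι
  · obtain ⟨c, rfl⟩ := hb'
    simpa [Finsupp.mapDomain_apply hinj] using ha c (hι _ _ hb)
  · rw [Finsupp.mapDomain_of_notMem_range _ _ hb', Finsupp.mapDomain_of_notMem_range _ _ hb']

end monoLt

open MvPolynomial

/-! ### Gröbner bases in possibly infinitely many variables -/

section Groebner

variable {K A : Type*} [Field K] {r : A → A → Prop}

/-- `m` is the largest monomial of `f`. -/
def IsTopMonomial (r : A → A → Prop) (m : A →₀ ℕ) (f : MvPolynomial A K) : Prop :=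
  coeff m f ≠ 0 ∧ ∀ n, coeff n f ≠ 0 → n = m ∨ monoLt r n m

/-- Sums of terms `c · u · p`, for `(l, p) ∈ X`, such that the monomial `u · l` satisfies `P`. -/
noncomputable def combinations (X : Set ((A →₀ ℕ) × MvPolynomial A K)) (P : (A →₀ ℕ) → Prop) :
    AddSubmonoid (MvPolynomial A K) :=
  AddSubmonoid.closure {q | ∃ c u, ∃ x ∈ X, P (u + x.1) ∧ q = monomial u c * x.2}

variable {X : Set ((A →₀ ℕ) × MvPolynomial A K)} {P Q : (A →₀ ℕ) → Prop} {f g : MvPolynomial A K}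

theorem mem_combinations {c : K} {u : A →₀ ℕ} {x : (A →₀ ℕ) × MvPolynomial A K} (hx : x ∈ X)
    (h : P (u + x.1)) : monomial u c * x.2 ∈ combinations X P :=
  AddSubmonoid.subset_closure ⟨c, u, x, hx, h, rfl⟩

theorem combinations_mono (h : ∀ n, P n → Q n) : combinations X P ≤ combinations X Q := by
  refine AddSubmonoid.closure_mono ?_
  rintro _ ⟨c, u, x, hx, hP, rfl⟩
  exact ⟨c, u, x, hx, h _ hP, rfl⟩

theorem monomial_mul_mem_combinations {w : A →₀ ℕ} (c : K) (h : ∀ n, P n → Q (w + n))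
    (hf : f ∈ combinations X P) : monomial w c * f ∈ combinations X Q := by
  induction hf using AddSubmonoid.closure_induction with
  | mem q hq =>
    obtain ⟨d, u, x, hx, hP, rfl⟩ := hq
    rw [← mul_assoc, monomial_mul]
    exact mem_combinations hx (by simpa [add_assoc] using h _ hP)
  | zero => simp
  | add x y _ _ ihx ihy => simpa [mul_add] using add_mem ihx ihy

theorem mul_mem_combinations (g : MvPolynomial A K) (hf : f ∈ combinations X fun _ => True) :
    g * f ∈ combinations X fun _ => True := by
  induction g using MvPolynomial.induction_on' with
  | monomial u c => exact monomial_mul_mem_combinations c (fun _ h => h) hf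
  | add p q hp hq => rw [add_mul]; exact add_mem hp hq

variable [IsWellOrder A r]

theorem exists_isTopMonomial (hf : f ≠ 0) : ∃ m, IsTopMonomial r m f := by
  obtain ⟨m₀, hm₀⟩ := MvPolynomial.ne_zero_iff.1 hf
  have : Std.Irrefl (monoLt r) := ⟨monoLt_irrefl⟩
  have : IsTrans (A →₀ ℕ) (monoLt r) := ⟨fun _ _ _ => monoLt_trans⟩
  have hwf : (↑f.support : Set (A →₀ ℕ)).WellFoundedOn (Function.swap (monoLt r)) := by
    have : Std.Irrefl (Function.swap (monoLt r)) := ⟨monoLt_irrefl⟩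
    have : IsTrans (A →₀ ℕ) (Function.swap (monoLt r)) := ⟨fun _ _ _ h h' => monoLt_trans h' h⟩
    have : IsStrictOrder (A →₀ ℕ) (Function.swap (monoLt r)) := {}
    exact f.support.finite_toSet.wellFoundedOn
  obtain ⟨⟨m, hm⟩, -, hmax⟩ := hwf.has_min Set.univ ⟨⟨m₀, by simpa using hm₀⟩, trivial⟩
  refine ⟨m, by simpa using hm, fun n hn => ?_⟩
  by_contra! H
  rcases monoLt_or_of_ne (r := r) H.1 with h | h
  · exact H.2 h
  · exact hmax ⟨n, by simpa using hn⟩ trivial h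

omit [IsWellOrder A r] in
theorem coeff_monomial_mul_ne_zero {u n : A →₀ ℕ} {c : K} (h : coeff n (monomial u c * f) ≠ 0) :
    ∃ k, n = u + k ∧ coeff k f ≠ 0 := by
  classical
  rw [coeff_monomial_mul'] at h
  split_ifs at h with hu
  · exact ⟨n - u, (add_tsub_cancel_of_le hu).symm, right_ne_zero_of_mul h⟩
  · exact absurd rfl h

/-- Every element of `X` consists of a monic polynomial and its largest monomial. -/
def IsMonicSet (r : A → A → Prop) (X : Set ((A →₀ ℕ) × MvPolynomial A K)) : Prop :=
  ∀ x ∈ X, coeff x.1 x.2 = 1 ∧ ∀ n, coeff n x.2 ≠ 0 → n = x.1 ∨ monoLt r n x.1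

theorem monoLt_of_mem_combinations (hX : IsMonicSet r X) {m : A →₀ ℕ}
    (hf : f ∈ combinations X (monoLt r · m)) {n : A →₀ ℕ} (hn : coeff n f ≠ 0) :
    monoLt r n m := by
  induction hf using AddSubmonoid.closure_induction generalizing n with
  | mem q hq =>
    obtain ⟨d, u, x, hx, hP, rfl⟩ := hq
    obtain ⟨k, rfl, hk⟩ := coeff_monomial_mul_ne_zero hn
    rcases (hX x hx).2 k hk with rfl | h
    · exact hP
    · exact monoLt_trans (monoLt_add_left h u) hP
  | zero => simp at hn
  | add x y _ _ ihx ihy =>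
    by_cases h : coeff n x = 0
    · exact ihy fun h' => hn (by simp [h, h'])
    · exact ihx h

omit [IsWellOrder A r] in
theorem coeff_add_monomial_mul (hX : IsMonicSet r X) {x} (hx : x ∈ X) (u : A →₀ ℕ) (c : K) :
    coeff (u + x.1) (monomial u c * x.2) = c := by
  rw [coeff_monomial_mul, (hX x hx).1, mul_one]

/-- The `S`-polynomials of elements of `X` are combinations of elements of `X` with terms below the
least common multiple of the leading monomials. -/
def IsBuchberger (r : A → A → Prop) (X : Set ((A →₀ ℕ) × MvPolynomial A K)) : Prop :=
  ∀ x ∈ X, ∀ y ∈ X, ∃ u v : A →₀ ℕ, u + x.1 = v + y.1 ∧ (∀ a, u a = 0 ∨ v a = 0) ∧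
    monomial u 1 * x.2 - monomial v 1 * y.2 ∈ combinations X (monoLt r · (u + x.1))

-- Disjointness of `u₀` and `v₀` makes `u₀ + x.1` the least common multiple, so any cancellation at
-- a common multiple `m` is a monomial multiple of the `S`-polynomial.
omit [IsWellOrder A r] in
theorem IsBuchberger.sub_mem (hS : IsBuchberger r X) {x y} (hx : x ∈ X) (hy : y ∈ X)
    {u v m : A →₀ ℕ} (hu : u + x.1 = m) (hv : v + y.1 = m) (c : K) :
    monomial u c * x.2 - monomial v c * y.2 ∈ combinations X (monoLt r · m) := by
  obtain ⟨u₀, v₀, h, hd, hmem⟩ := hS x hx y hy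
  have key : ∀ a, u₀ a ≤ u a ∧ (u a - u₀ a) + v₀ a = v a := by
    intro a
    have h1 := DFunLike.congr_fun h a
    have h2 := DFunLike.congr_fun (hu.trans hv.symm) a
    simp only [Finsupp.add_apply] at h1 h2
    rcases hd a with h3 | h3 <;> omega
  have e1 : u = (u - u₀) + u₀ := by
    ext a; have := key a; simp only [Finsupp.add_apply, Finsupp.tsub_apply]; omega
  have e2 : v = (u - u₀) + v₀ := by
    ext a; have := key a; simp only [Finsupp.add_apply, Finsupp.tsub_apply]; omega
  have e3 : monomial u c * x.2 - monomial v c * y.2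
      = monomial (u - u₀) c * (monomial u₀ 1 * x.2 - monomial v₀ 1 * y.2) := by
    rw [mul_sub, ← mul_assoc, ← mul_assoc, monomial_mul, monomial_mul, mul_one, ← e1, ← e2]
  rw [e3]
  refine monomial_mul_mem_combinations c (fun n hn => ?_) hmem
  have := monoLt_add_left hn (u - u₀)
  rwa [← add_assoc, ← e1, hu] at this

/-- Buchberger's criterion: among the representations of `f`, one with a minimal bound on its terms
has no cancellation at the top, so the leading monomial of `f` is that of one of the terms. -/
theorem IsBuchberger.exists_le_top (hX : IsMonicSet r X) (hS : IsBuchberger r X)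
    (hf : f ∈ combinations X fun _ => True) {k : A →₀ ℕ} (hk : IsTopMonomial r k f) :
    ∃ x ∈ X, x.1 ≤ k := by
  have hf0 : f ≠ 0 := fun h => hk.1 (by simp [h])
  -- The induction is on the bound `m` for the terms of a representation, not on the leading
  -- monomial of `f`, which may be smaller because of cancellation.
  suffices H : ∀ m, ∀ f ∈ combinations X (fun n => n = m ∨ monoLt r n m), f ≠ 0 →
      ∃ x ∈ X, ∃ u, coeff (u + x.1) f ≠ 0 ∧ ∀ n, coeff n f ≠ 0 → n = u + x.1 ∨
        monoLt r n (u + x.1) by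
    have : f = 0 ∨ ∃ m, f ∈ combinations X (fun n => n = m ∨ monoLt r n m) := by
      clear hk hf0
      induction hf using AddSubmonoid.closure_induction with
      | mem q hq =>
        obtain ⟨d, u, x, hx, -, rfl⟩ := hq
        exact .inr ⟨u + x.1, mem_combinations hx (.inl rfl)⟩
      | zero => exact .inl rfl
      | add x y _ _ ihx ihy =>
        rcases ihx with rfl | ⟨m, hm⟩
        · simpa using ihy
        rcases ihy with rfl | ⟨n, hn⟩
        · exact .inr ⟨m, by simpa using hm⟩
        right
        by_cases hmn : m = n
        · subst hmn; exact ⟨m, add_mem hm hn⟩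
        rcases monoLt_or_of_ne (r := r) hmn with h | h
        · refine ⟨n, add_mem (combinations_mono ?_ hm) hn⟩
          rintro k (rfl | hk)
          exacts [.inr h, .inr (monoLt_trans hk h)]
        · refine ⟨m, add_mem hm (combinations_mono ?_ hn)⟩
          rintro k (rfl | hk)
          exacts [.inr h, .inr (monoLt_trans hk h)]
    obtain ⟨m, hm⟩ := this.resolve_left hf0
    obtain ⟨x, hx, u, hc, hu⟩ := H m f hm hf0
    refine ⟨x, hx, ?_⟩
    have : k = u + x.1 := by
      rcases hk.2 _ hc with h | h
      · exact h.symm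
      rcases hu _ hk.1 with h' | h'
      · exact h'
      · exact absurd (monoLt_trans h h') (monoLt_irrefl _)
    rw [this]; exact self_le_add_left _ _
  intro m
  induction m using (monoLt_wf (r := r)).induction with
  | _ m IH =>
  intro f hf hf0
  -- A representation has finitely many terms, so a strict bound `m` can be replaced by an attained
  -- bound below `m`, to which the induction hypothesis applies.
  have hlt : ∀ g ∈ combinations X (monoLt r · m), g ≠ 0 →
      ∃ m', monoLt r m' m ∧ g ∈ combinations X (fun n => n = m' ∨ monoLt r n m') := by
    intro g hg
    induction hg using AddSubmonoid.closure_induction with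
    | mem q hq =>
      obtain ⟨d, u, x, hx, h, rfl⟩ := hq
      exact fun _ => ⟨u + x.1, h, mem_combinations hx (.inl rfl)⟩
    | zero => exact fun h => absurd rfl h
    | add x y _ _ ihx ihy =>
      intro _
      by_cases hx0 : x = 0
      · subst hx0; simpa using ihy (by simpa using ‹0 + y ≠ 0›)
      by_cases hy0 : y = 0
      · subst hy0; simpa using ihx (by simpa using ‹x + 0 ≠ 0›)
      obtain ⟨m₁, h₁, hm₁⟩ := ihx hx0
      obtain ⟨m₂, h₂, hm₂⟩ := ihy hy0
      by_cases hmn : m₁ = m₂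
      · subst hmn; exact ⟨m₁, h₁, add_mem hm₁ hm₂⟩
      rcases monoLt_or_of_ne (r := r) hmn with h | h
      · refine ⟨m₂, h₂, add_mem (combinations_mono ?_ hm₁) hm₂⟩
        rintro k (rfl | hk)
        exacts [.inr h, .inr (monoLt_trans hk h)]
      · refine ⟨m₁, h₁, add_mem hm₁ (combinations_mono ?_ hm₂)⟩
        rintro k (rfl | hk)
        exacts [.inr h, .inr (monoLt_trans hk h)]
  by_cases hex : ∃ u₀, ∃ x₀ ∈ X, u₀ + x₀.1 = m
  · obtain ⟨u₀, x₀, hx₀, hm⟩ := hex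
    -- All terms at level `m` are traded for multiples of the one element `x₀`, at the cost of terms
    -- below `m`. If the collected coefficient vanishes, the bound drops; otherwise `m` is the
    -- leading monomial.
    have key : ∃ c, ∃ g ∈ combinations X (monoLt r · m), f = monomial u₀ c * x₀.2 + g := by
      clear hf0
      induction hf using AddSubmonoid.closure_induction with
      | mem q hq =>
        obtain ⟨d, u, x, hx, h | h, rfl⟩ := hq
        · exact ⟨d, _, hS.sub_mem hx hx₀ h hm d, by ring⟩
        · exact ⟨0, _, mem_combinations (c := d) hx h, by simp⟩
      | zero => exact ⟨0, 0, zero_mem _, by simp⟩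
      | add x y _ _ ihx ihy =>
        obtain ⟨c, g, hg, rfl⟩ := ihx
        obtain ⟨d, h, hh, rfl⟩ := ihy
        exact ⟨c + d, g + h, add_mem hg hh, by rw [map_add]; ring⟩
    obtain ⟨c, g, hg, rfl⟩ := key
    by_cases hc : c = 0
    · subst hc
      have hg0 : g ≠ 0 := by simpa using hf0
      obtain ⟨m', hm', hgm'⟩ := hlt g hg hg0
      simpa using IH m' hm' g hgm' hg0
    · refine ⟨x₀, hx₀, u₀, ?_, fun n hn => ?_⟩
      · rw [coeff_add, coeff_add_monomial_mul hX hx₀]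
        have : coeff (u₀ + x₀.1) g = 0 := by
          by_contra h
          have := monoLt_of_mem_combinations hX hg h
          rw [hm] at this
          exact monoLt_irrefl _ this
        rwa [this, add_zero]
      · by_cases hn' : coeff n g = 0
        · rw [coeff_add, hn', add_zero] at hn
          obtain ⟨k, rfl, hk⟩ := coeff_monomial_mul_ne_zero hn
          rcases (hX x₀ hx₀).2 k hk with rfl | h
          · exact .inl rfl
          · exact .inr (monoLt_add_left h _)
        · rw [hm]; exact .inr (monoLt_of_mem_combinations hX hg hn')
  · have : f ∈ combinations X (monoLt r · m) := by
      refine AddSubmonoid.closure_mono ?_ hf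
      rintro _ ⟨c, u, x, hx, h | h, rfl⟩
      · exact absurd ⟨u, x, hx, h⟩ hex
      · exact ⟨c, u, x, hx, h, rfl⟩
    obtain ⟨m', hm', hfm'⟩ := hlt f this hf0
    exact IH m' hm' f hfm' hf0

/-- Leading monomials of elements of `I` are divisible by leading monomials of elements of `X`. -/
def IsGroebner (r : A → A → Prop) (I : Ideal (MvPolynomial A K))
    (X : Set ((A →₀ ℕ) × MvPolynomial A K)) : Prop :=
  (∀ x ∈ X, x.2 ∈ I) ∧ ∀ f ∈ I, ∀ m, IsTopMonomial r m f → ∃ x ∈ X, x.1 ≤ m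

variable {I : Ideal (MvPolynomial A K)}

omit [IsWellOrder A r] in
theorem IsGroebner.exists_sub (hX : IsMonicSet r X) (hI : IsGroebner r I X) (hf : f ∈ I)
    {k : A →₀ ℕ} (hk : IsTopMonomial r k f) : ∃ u, ∃ x ∈ X, u + x.1 = k ∧ ∃ c,
      f - monomial u c * x.2 ∈ I ∧ ∀ n, coeff n (f - monomial u c * x.2) ≠ 0 → monoLt r n k := by
  obtain ⟨x, hx, hle⟩ := hI.2 f hf k hk
  have hu : k - x.1 + x.1 = k := tsub_add_cancel_of_le hle
  refine ⟨k - x.1, x, hx, hu, coeff k f, sub_mem hf (I.mul_mem_left _ (hI.1 x hx)), fun n hn => ?_⟩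
  have hnk : n = k ∨ monoLt r n k := by
    by_cases h : coeff n f = 0
    · rw [coeff_sub, h, zero_sub, neg_ne_zero] at hn
      obtain ⟨j, rfl, hj⟩ := coeff_monomial_mul_ne_zero hn
      rcases (hX x hx).2 j hj with rfl | h
      · exact .inl hu
      · right; have := monoLt_add_left h (k - x.1); rwa [hu] at this
    · exact hk.2 n h
  refine hnk.resolve_left ?_
  rintro rfl
  have h1 := coeff_add_monomial_mul hX hx (n - x.1) (coeff n f)
  rw [hu] at h1
  exact hn (by rw [coeff_sub, h1, sub_self])

/-- Division by `X`: every step uses a multiple whose leading monomial is the current one, so all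
terms used stay below `m`. -/
theorem IsGroebner.mem_combinations_lt (hX : IsMonicSet r X) (hI : IsGroebner r I X)
    (m : A →₀ ℕ) : ∀ f ∈ I, (∀ n, coeff n f ≠ 0 → monoLt r n m) →
      f ∈ combinations X (monoLt r · m) := by
  induction m using (monoLt_wf (r := r)).induction with
  | _ m IH =>
  intro f hf hlt
  by_cases hf0 : f = 0
  · subst hf0; exact zero_mem _
  obtain ⟨k, hk⟩ := exists_isTopMonomial (r := r) hf0
  have hkm := hlt k hk.1
  obtain ⟨u, x, hx, hu, c, hmem, hlt'⟩ := hI.exists_sub hX hf hk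
  have := combinations_mono (fun n hn => monoLt_trans hn hkm) (IH k hkm _ hmem hlt')
  have h2 := add_mem this (mem_combinations (P := (monoLt r · m)) (c := c) hx (by rwa [hu]))
  simpa using h2

theorem IsGroebner.mem_combinations (hX : IsMonicSet r X) (hI : IsGroebner r I X) (hf : f ∈ I) :
    f ∈ combinations X fun _ => True := by
  by_cases hf0 : f = 0
  · subst hf0; exact zero_mem _
  obtain ⟨k, hk⟩ := exists_isTopMonomial (r := r) hf0
  obtain ⟨u, x, hx, hu, c, hmem, hlt'⟩ := hI.exists_sub hX hf hk
  have := combinations_mono (Q := fun _ => True) (fun n hn => trivial)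
    (hI.mem_combinations_lt hX k _ hmem hlt')
  have h2 := add_mem this (_root_.mem_combinations (P := fun _ => True) (c := c) (u := u) hx trivial)
  simpa using h2

/-- Truncated subtraction yields the cofactors up to the least common multiple; there the monic
leading terms cancel, and division handles the rest. -/
theorem IsGroebner.isBuchberger (hX : IsMonicSet r X) (hI : IsGroebner r I X) :
    IsBuchberger r X := by
  intro x hx y hy
  have huv : (y.1 - x.1) + x.1 = (x.1 - y.1) + y.1 := by
    ext a; simp only [Finsupp.add_apply, Finsupp.tsub_apply]; omega
  refine ⟨y.1 - x.1, x.1 - y.1, huv,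
    fun a => by simp only [Finsupp.tsub_apply]; omega, hI.mem_combinations_lt hX _ _
      (sub_mem (I.mul_mem_left _ (hI.1 x hx)) (I.mul_mem_left _ (hI.1 y hy))) fun n hn => ?_⟩
  have h1 : ∀ (u : A →₀ ℕ) (z), z ∈ X → coeff n (monomial u 1 * z.2) ≠ 0 →
      n = u + z.1 ∨ monoLt r n (u + z.1) := by
    intro u z hz h
    obtain ⟨j, rfl, hj⟩ := coeff_monomial_mul_ne_zero h
    rcases (hX z hz).2 j hj with rfl | h
    · exact .inl rfl
    · exact .inr (monoLt_add_left h _)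
  have h2 : n = (y.1 - x.1) + x.1 ∨ monoLt r n ((y.1 - x.1) + x.1) := by
    by_cases h : coeff n (monomial (y.1 - x.1) 1 * x.2) = 0
    · rw [huv]
      refine h1 _ y hy fun h' => hn (by rw [coeff_sub, h, h', sub_zero])
    · exact h1 _ x hx h
  refine h2.resolve_left ?_
  rintro rfl
  apply hn
  rw [coeff_sub, coeff_add_monomial_mul hX hx, huv, coeff_add_monomial_mul hX hy, sub_self]

/-- Cancelling a divisible leading term lowers the leading monomial, so the process must stop; it
cannot stop at 0 because `f ∉ I`. -/
theorem IsGroebner.exists_remainder (hX : IsMonicSet r X) (hI : IsGroebner r I X) (hf : f ∉ I) :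
    ∃ g, g - f ∈ I ∧ ∃ m, IsTopMonomial r m g ∧ ¬∃ x ∈ X, x.1 ≤ m := by
  by_contra! H
  have hne : ∀ g, g - f ∈ I → g ≠ 0 := by
    rintro g hg rfl
    exact hf (by simpa using hg)
  have : ∀ m, ∀ g, g - f ∈ I → ¬IsTopMonomial r m g := by
    intro m
    induction m using (monoLt_wf (r := r)).induction with
    | _ m IH =>
    intro g hg hm
    obtain ⟨x, hx, hle⟩ := H g hg m hm
    have hu : m - x.1 + x.1 = m := tsub_add_cancel_of_le hle
    set g' := g - monomial (m - x.1) (coeff m g) * x.2 with hg'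
    have hmem : g' - f ∈ I := by
      have : g' - f = (g - f) - monomial (m - x.1) (coeff m g) * x.2 := by rw [hg']; ring
      rw [this]; exact sub_mem hg (I.mul_mem_left _ (hI.1 x hx))
    obtain ⟨k, hk⟩ := exists_isTopMonomial (r := r) (hne g' hmem)
    refine IH k ?_ g' hmem hk
    have hkm : k = m ∨ monoLt r k m := by
      by_cases h : coeff k g = 0
      · have hk1 := hk.1
        rw [hg', coeff_sub, h, zero_sub, neg_ne_zero] at hk1
        obtain ⟨j, rfl, hj⟩ := coeff_monomial_mul_ne_zero hk1
        rcases (hX x hx).2 j hj with rfl | h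
        · exact .inl hu
        · right; have := monoLt_add_left h (m - x.1); rwa [hu] at this
      · exact hm.2 k h
    refine hkm.resolve_left ?_
    rintro rfl
    have h1 := coeff_add_monomial_mul hX hx (k - x.1) (coeff k g)
    rw [hu] at h1
    exact hk.1 (by rw [hg', coeff_sub, h1, sub_self])
  obtain ⟨m, hm⟩ := exists_isTopMonomial (r := r) (hne f (by simp))
  exact this m f (by simp) hm

end Groebner

/-! ### Quantifier-free formulas and well quasi orders -/

theorem realize_isQF_comp_embedding {L : Language} {M N α : Type*} [L.Structure M] [L.Structure N]
    (ι : M ↪[L] N) {k : ℕ} {φ : L.BoundedFormula α k} (h : φ.IsQF) (v : α → M) (xs : Fin k → M) :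
    φ.Realize (ι ∘ v) (ι ∘ xs) ↔ φ.Realize v xs := by
  have hterm : ∀ t : L.Term (α ⊕ Fin k),
      t.realize (Sum.elim (ι ∘ v) (ι ∘ xs)) = ι (t.realize (Sum.elim v xs)) := by
    intro t
    rw [← Sum.comp_elim, Language.HomClass.realize_term]
  induction h with
  | falsum => rfl
  | of_isAtomic h =>
    cases h with
    | equal t₁ t₂ => simp [Language.BoundedFormula.realize_bdEqual, hterm]
    | rel R ts =>
      simp only [Language.BoundedFormula.realize_rel, hterm]
      exact ι.map_rel R fun i => (ts i).realize (Sum.elim v xs)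
  | imp _ _ ih₁ ih₂ => simp only [Language.BoundedFormula.realize_imp, ih₁, ih₂]

/-- Otherwise each finite subset of `S` could be extended by an element above none of its members,
which builds a bad sequence. -/
theorem WellQuasiOrdered.exists_finset_basis {α : Type*} {R : α → α → Prop}
    (h : WellQuasiOrdered R) (S : Set α) :
    ∃ T : Finset α, (∀ x ∈ T, x ∈ S) ∧ ∀ x ∈ S, ∃ y ∈ T, R y x := by
  by_contra! H
  obtain ⟨f, -, hf⟩ := exists_seq_of_forall_finset_exists (· ∈ S) (fun x y => ¬R x y) H
  obtain ⟨m, n, hmn, hR⟩ := h f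
  exact hf m n hmn hR

/-! ### Orbits and equivariant Gröbner bases -/

section Equivariant

variable (L : Language) {K A : Type*} [Field K] [L.Structure A]

/-- A monomial is its support labelled by exponents. -/
theorem wellQuasiOrdered_mapDomain_le (h : OmegaWellStructured L A) :
    WellQuasiOrdered fun m n : A →₀ ℕ => ∃ ι : A ↪[L] A, m.mapDomain ι ≤ n := by
  intro f
  obtain ⟨i, j, hij, ι, h₁, h₂⟩ :=
    h fun i => (⟨(f i).support, fun b => f i b⟩ : LabelledAge A ℕ)
  refine ⟨i, j, hij, ι, fun a => ?_⟩
  by_cases ha : a ∈ Set.range ι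
  · obtain ⟨b, rfl⟩ := ha
    rw [Finsupp.mapDomain_apply ι.injective]
    by_cases hb : b ∈ (f i).support
    · exact h₂ ⟨b, hb⟩
    · simp [Finsupp.notMem_support_iff.1 hb]
  · simp [Finsupp.mapDomain_of_notMem_range _ _ ha]

theorem exists_list_pairs (h : OmegaWellStructured L A) (R : A → A → Prop)
    (hR : ∀ a, ¬R a a) : ∃ F : List (A × A), (∀ p ∈ F, R p.1 p.2) ∧
      ∀ a b, R a b → ∃ p ∈ F, ∃ ι : A ↪[L] A, ι p.1 = a ∧ ι p.2 = b := by
  classical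
  -- The pair `(a, b)` is encoded by the monomial `a b²`; the distinct exponents record which entry
  -- comes first.
  obtain ⟨T, hT, hT'⟩ := (wellQuasiOrdered_mapDomain_le L h).exists_finset_basis
    {m | ∃ a b, R a b ∧ m = Finsupp.single a 1 + Finsupp.single b 2}
  rcases isEmpty_or_nonempty A with hA | hA
  · exact ⟨[], by simp, fun a => isEmptyElim a⟩
  choose! p q hpq hm using hT
  refine ⟨T.toList.map fun m => (p m, q m), ?_, fun a b hab => ?_⟩
  · simp only [List.mem_map, Finset.mem_toList]
    rintro _ ⟨m, hm, rfl⟩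
    exact hpq m hm
  · obtain ⟨m, hmT, ι, hι⟩ := hT' _ ⟨a, b, hab, rfl⟩
    refine ⟨(p m, q m), List.mem_map.2 ⟨m, Finset.mem_toList.2 hmT, rfl⟩, ι, ?_⟩
    have hne : p m ≠ q m := fun e => hR (q m) (by simpa [e] using hpq m hmT)
    have hne' : a ≠ b := fun e => hR b (by simpa [e] using hab)
    rw [hm m hmT, Finsupp.mapDomain_add, Finsupp.mapDomain_single, Finsupp.mapDomain_single] at hι
    have h1 := hι (ι (p m))
    have h2 := hι (ι (q m))
    simp only [Finsupp.add_apply, Finsupp.single_apply, ι.injective.eq_iff, hne, hne.symm,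
      if_true, if_false] at h1 h2
    -- Irreflexivity makes the entries distinct, so exponent 2 occurs only at `b`; the remaining
    -- variable must then go to `a`.
    have hq : b = ι (q m) := by
      by_contra hb
      simp only [hb, if_false] at h2
      split_ifs at h2 <;> omega
    have hp : a = ι (p m) := by
      by_contra ha
      have hb : b ≠ ι (p m) := fun e => hne (ι.injective (e.symm.trans hq))
      simp [ha, hb] at h1
    exact ⟨hp.symm, hq.symm⟩

/-- The action of an embedding on a polynomial with a distinguished monomial. -/
noncomputable def embAct (ι : A ↪[L] A) (x : (A →₀ ℕ) × MvPolynomial A K) :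
    (A →₀ ℕ) × MvPolynomial A K :=
  (x.1.mapDomain ι, rename ι x.2)

/-- The union of the orbits of the elements of `S`. -/
def orbit (S : Set ((A →₀ ℕ) × MvPolynomial A K)) : Set ((A →₀ ℕ) × MvPolynomial A K) :=
  {x | ∃ y ∈ S, ∃ ι : A ↪[L] A, x = embAct L ι y}

variable {L}

theorem embAct_comp (κ ι : A ↪[L] A) (x : (A →₀ ℕ) × MvPolynomial A K) :
    embAct L (κ.comp ι) x = embAct L κ (embAct L ι x) := by
  simp only [embAct, Language.Embedding.comp, rename_rename, ← Finsupp.mapDomain_comp]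
  rfl

theorem embAct_refl (x : (A →₀ ℕ) × MvPolynomial A K) :
    embAct L (Language.Embedding.refl L A) x = x := by
  have : (Language.Embedding.refl L A : A → A) = id := rfl
  simp [embAct, this]

variable {S : Set ((A →₀ ℕ) × MvPolynomial A K)} {x : (A →₀ ℕ) × MvPolynomial A K}

theorem subset_orbit : S ⊆ orbit L S :=
  fun x hx => ⟨x, hx, Language.Embedding.refl L A, (embAct_refl x).symm⟩

theorem embAct_mem_orbit (κ : A ↪[L] A) (hx : x ∈ orbit L S) : embAct L κ x ∈ orbit L S := by
  obtain ⟨y, hy, ι, rfl⟩ := hx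
  exact ⟨y, hy, κ.comp ι, (embAct_comp κ ι y).symm⟩

theorem rename_mem_combinations {P Q : (A →₀ ℕ) → Prop} (κ : A ↪[L] A)
    (h : ∀ n, P n → Q (n.mapDomain κ)) {f : MvPolynomial A K}
    (hf : f ∈ combinations (orbit L S) P) : rename κ f ∈ combinations (orbit L S) Q := by
  induction hf using AddSubmonoid.closure_induction with
  | mem q hq =>
    obtain ⟨d, u, x, hx, hP, rfl⟩ := hq
    rw [map_mul, rename_monomial]
    have hQ := h _ hP
    rw [Finsupp.mapDomain_add] at hQ
    exact mem_combinations (x := embAct L κ x) (embAct_mem_orbit κ hx) hQ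
  | zero => simp
  | add x y _ _ ihx ihy => rw [map_add]; exact add_mem ihx ihy

theorem isEquivariantIdeal_equivariantSpan (T : Set (MvPolynomial A K)) :
    IsEquivariantIdeal L (equivariantSpan L T) := by
  intro ι f hf
  rw [equivariantSpan, Submodule.mem_sInf] at hf ⊢
  exact fun I hI => hI.1 ι f (hf I hI)

theorem subset_equivariantSpan (T : Set (MvPolynomial A K)) :
    ∀ f ∈ T, f ∈ equivariantSpan L T := by
  intro f hf
  rw [equivariantSpan, Submodule.mem_sInf]
  exact fun I hI => hI.2 hf

theorem equivariantSpan_le {T : Set (MvPolynomial A K)} {I : Ideal (MvPolynomial A K)}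
    (hI : IsEquivariantIdeal L I) (h : ∀ f ∈ T, f ∈ I) : equivariantSpan L T ≤ I :=
  sInf_le ⟨hI, h⟩

variable (L) in
/-- The equivariant ideal generated by the polynomials in `S`, as the set of all combinations of
elements of their orbits. -/
noncomputable def orbitIdeal (S : Set ((A →₀ ℕ) × MvPolynomial A K)) :
    Ideal (MvPolynomial A K) where
  __ := combinations (orbit L S) fun _ => True
  smul_mem' g _ hf := mul_mem_combinations g hf

theorem mem_orbitIdeal {f : MvPolynomial A K} :
    f ∈ orbitIdeal L S ↔ f ∈ combinations (orbit L S) fun _ => True := Iff.rfl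

theorem isEquivariantIdeal_orbitIdeal : IsEquivariantIdeal L (orbitIdeal L S) :=
  fun ι _ hf => rename_mem_combinations ι (fun _ h => h) hf

theorem snd_mem_orbitIdeal (hx : x ∈ S) : x.2 ∈ orbitIdeal L S := by
  have := mem_combinations (P := fun _ => True) (c := (1 : K)) (u := 0)
    (subset_orbit (L := L) hx) trivial
  exact mem_orbitIdeal.2 (by simpa using this)

theorem orbitIdeal_le {I : Ideal (MvPolynomial A K)} (hI : IsEquivariantIdeal L I)
    (h : ∀ x ∈ S, x.2 ∈ I) : orbitIdeal L S ≤ I := by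
  intro f hf
  replace hf := mem_orbitIdeal.1 hf
  induction hf using AddSubmonoid.closure_induction with
  | mem q hq =>
    obtain ⟨d, u, _, ⟨y, hy, ι, rfl⟩, -, rfl⟩ := hq
    exact I.mul_mem_left _ (hI ι _ (h y hy))
  | zero => exact zero_mem _
  | add x y _ _ ihx ihy => exact add_mem ihx ihy

/-- Orbits are closed under embeddings, so the combinations of their elements already form an
equivariant ideal. -/
theorem equivariantSpan_eq_orbitIdeal :
    equivariantSpan L (Prod.snd '' S) = orbitIdeal L S := by
  apply le_antisymm
  · refine equivariantSpan_le isEquivariantIdeal_orbitIdeal ?_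
    rintro _ ⟨x, hx, rfl⟩
    exact snd_mem_orbitIdeal hx
  · exact orbitIdeal_le (isEquivariantIdeal_equivariantSpan _) fun x hx =>
      subset_equivariantSpan _ _ ⟨x, hx, rfl⟩

variable {r : A → A → Prop}

theorem IsMonicSet.orbit (hι : ∀ (ι : A ↪[L] A) a b, r (ι a) (ι b) ↔ r a b)
    (hS : IsMonicSet r S) : IsMonicSet r (orbit L S) := by
  rintro _ ⟨y, hy, ι, rfl⟩
  refine ⟨?_, fun n hn => ?_⟩
  · simpa [embAct, coeff_rename_mapDomain _ ι.injective] using (hS y hy).1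
  · obtain ⟨u, rfl, hu⟩ := coeff_rename_ne_zero _ _ _ hn
    rcases (hS y hy).2 u hu with rfl | h
    · exact .inl rfl
    · exact .inr (monoLt_mapDomain ι.injective (fun a b => (hι ι a b).1) h)

/-- Renaming along `κ` preserves the monomial order, orbits and disjointness of cofactors, so a
reduction of one `S`-polynomial yields a reduction of its image. -/
theorem isBuchberger_orbit (hι : ∀ (ι : A ↪[L] A) a b, r (ι a) (ι b) ↔ r a b)
    (H : ∀ x ∈ orbit L S, ∀ y ∈ orbit L S, ∃ x₁ ∈ orbit L S, ∃ y₁ ∈ orbit L S, ∃ κ : A ↪[L] A,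
      x = embAct L κ x₁ ∧ y = embAct L κ y₁ ∧
      ∃ u v : A →₀ ℕ, u + x₁.1 = v + y₁.1 ∧ (∀ a, u a = 0 ∨ v a = 0) ∧
        monomial u 1 * x₁.2 - monomial v 1 * y₁.2 ∈
          combinations (orbit L S) (monoLt r · (u + x₁.1))) :
    IsBuchberger r (orbit L S) := by
  intro x hx y hy
  obtain ⟨x₁, -, y₁, -, κ, rfl, rfl, u, v, huv, hd, hmem⟩ := H x hx y hy
  refine ⟨u.mapDomain κ, v.mapDomain κ, ?_, fun a => ?_, ?_⟩
  · simp only [embAct, ← Finsupp.mapDomain_add, huv]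
  · by_cases ha : a ∈ Set.range κ
    · obtain ⟨b, rfl⟩ := ha
      simpa [Finsupp.mapDomain_apply κ.injective] using hd b
    · simp [Finsupp.mapDomain_of_notMem_range _ _ ha]
  · have := rename_mem_combinations (Q := (monoLt r · ((u + x₁.1).mapDomain κ))) κ
      (fun n hn => monoLt_mapDomain κ.injective (fun a b => (hι κ a b).1) hn) hmem
    rw [Finsupp.mapDomain_add] at this
    simpa [embAct, map_sub, map_mul, rename_monomial] using this

/-- Take a finite basis of the leading monomials of `I` under divisibility up to embedding, and a
monic polynomial in `I` for each. -/
theorem exists_isGroebner (hws : OmegaWellStructured L A)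
    {I : Ideal (MvPolynomial A K)}
    (hI : IsEquivariantIdeal L I) : ∃ H : List ((A →₀ ℕ) × MvPolynomial A K),
      IsMonicSet r {x | x ∈ H} ∧ IsGroebner r I (orbit L {x | x ∈ H}) := by
  obtain ⟨T, hT, hT'⟩ := (wellQuasiOrdered_mapDomain_le L hws).exists_finset_basis
    {m | ∃ f ∈ I, IsTopMonomial r m f}
  have hmonic : ∀ m ∈ T, ∃ p ∈ I, coeff m p = 1 ∧ ∀ n, coeff n p ≠ 0 → n = m ∨ monoLt r n m := by
    intro m hm
    obtain ⟨f, hf, hmf⟩ := hT m hm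
    refine ⟨C (coeff m f)⁻¹ * f, I.mul_mem_left _ hf, ?_, fun n hn => ?_⟩
    · rw [coeff_C_mul, inv_mul_cancel₀ hmf.1]
    · rw [coeff_C_mul] at hn
      exact hmf.2 n (right_ne_zero_of_mul hn)
  choose! p hpI hp using hmonic
  refine ⟨T.toList.map fun m => (m, p m), ?_, ?_, ?_⟩
  · intro x hx
    simp only [Set.mem_ofPred_eq, List.mem_map, Finset.mem_toList] at hx
    obtain ⟨m, hm, rfl⟩ := hx
    exact hp m hm
  · rintro _ ⟨y, hy, ι, rfl⟩
    simp only [Set.mem_ofPred_eq, List.mem_map, Finset.mem_toList] at hy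
    obtain ⟨m, hm, rfl⟩ := hy
    exact hI ι _ (hpI m hm)
  · intro f hf k hk
    obtain ⟨m, hm, ι, hle⟩ := hT' k ⟨f, hf, hk⟩
    exact ⟨embAct L ι (m, p m), ⟨(m, p m), List.mem_map.2 ⟨m, Finset.mem_toList.2 hm, rfl⟩, ι, rfl⟩, hle⟩

end Equivariant

/-! ### Finite representations of monomials and polynomials -/

section Codes

variable {K A : Type*} [Field K]

/-- The monomial represented by a list of variables with exponents. -/
noncomputable def toMono (l : List (A × ℕ)) : A →₀ ℕ :=
  (l.map fun v => Finsupp.single v.1 v.2).sum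

@[simp] theorem toMono_nil : toMono ([] : List (A × ℕ)) = 0 := rfl

@[simp] theorem toMono_cons (v : A × ℕ) (l : List (A × ℕ)) :
    toMono (v :: l) = Finsupp.single v.1 v.2 + toMono l := rfl

@[simp] theorem toMono_append (l l' : List (A × ℕ)) : toMono (l ++ l') = toMono l + toMono l' := by
  simp [toMono]

theorem exists_of_toMono_ne_zero {l : List (A × ℕ)} {a : A} (h : toMono l a ≠ 0) :
    ∃ v ∈ l, v.1 = a := by
  classical
  induction l with
  | nil => simp at h
  | cons v l ih =>
    by_cases hv : v.1 = a
    · exact ⟨v, by simp, hv⟩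
    · obtain ⟨w, hw, hw'⟩ := ih (by simpa [Finsupp.single_apply, hv] using h)
      exact ⟨w, by simp [hw], hw'⟩

theorem le_toMono {l : List (A × ℕ)} {v : A × ℕ} (h : v ∈ l) : v.2 ≤ toMono l v.1 := by
  induction l with
  | nil => simp at h
  | cons w l ih =>
    rcases List.mem_cons.1 h with rfl | h
    · simp
    · exact (ih h).trans (by simp)

theorem prod_map_X_pow (l : List (A × ℕ)) :
    (l.map fun v => (X v.1 ^ v.2 : MvPolynomial A K)).prod = monomial (toMono l) 1 := by
  induction l with
  | nil => simp
  | cons v l ih =>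
    rw [List.map_cons, List.prod_cons, ih, X_pow_eq_monomial, monomial_mul, mul_one, toMono_cons]

theorem exists_toMono_eq (m : A →₀ ℕ) : ∃ l : List (A × ℕ), toMono l = m ∧ ∀ v ∈ l, v.2 ≠ 0 := by
  refine ⟨m.support.toList.map fun a => (a, m a), ?_, by simp⟩
  rw [toMono, List.map_map]
  exact (Finset.sum_map_toList m.support fun a => Finsupp.single a (m a)).trans (Finsupp.sum_single m)

namespace PolyCode

@[simp] theorem toPoly_nil : toPoly ([] : PolyCode K A) = 0 := rfl

@[simp] theorem toPoly_cons (t : K × List (A × ℕ)) (c : PolyCode K A) :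
    toPoly (t :: c) = monomial (toMono t.2) t.1 + toPoly c := by
  rw [toPoly, List.map_cons, List.sum_cons, prod_map_X_pow, C_mul_monomial, mul_one]
  rfl

@[simp] theorem toPoly_append (c d : PolyCode K A) : toPoly (c ++ d) = toPoly c + toPoly d := by
  simp [toPoly]

/-- The product of a term and a polynomial. -/
def mulTerm (t : K × List (A × ℕ)) (c : PolyCode K A) : PolyCode K A :=
  c.map fun s => (t.1 * s.1, t.2 ++ s.2)

@[simp] theorem toPoly_mulTerm (t : K × List (A × ℕ)) (c : PolyCode K A) :
    toPoly (mulTerm t c) = monomial (toMono t.2) t.1 * toPoly c := by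
  induction c with
  | nil => simp [mulTerm]
  | cons s c ih =>
    rw [mulTerm] at ih
    simp [mulTerm, ih, mul_add, monomial_mul]

theorem exists_of_coeff_ne_zero {c : PolyCode K A} {n : A →₀ ℕ} (h : coeff n (toPoly c) ≠ 0) :
    ∃ t ∈ c, toMono t.2 = n := by
  classical
  induction c with
  | nil => simp at h
  | cons t c ih =>
    by_cases ht : toMono t.2 = n
    · exact ⟨t, by simp, ht⟩
    · obtain ⟨s, hs, hs'⟩ := ih (by simpa [coeff_monomial, ht] using h)
      exact ⟨s, by simp [hs], hs'⟩

theorem exists_toPoly_eq (p : MvPolynomial A K) :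
    ∃ c : PolyCode K A, toPoly c = p ∧ ∀ t ∈ c, coeff (toMono t.2) p ≠ 0 := by
  choose l hl using fun m : A →₀ ℕ => exists_toMono_eq m
  refine ⟨p.support.toList.map fun m => (coeff m p, l m), ?_, ?_⟩
  · conv_rhs => rw [as_sum p, ← Finset.sum_map_toList]
    induction p.support.toList with
    | nil => simp
    | cons m s ih => simp [ih, (hl m).1]
  · simp [(hl _).1]

/-- The list of all occurrences of variables. -/
def vars (c : PolyCode K A) : List A := c.flatMap fun t => t.2.map Prod.fst

/-- What remains of a code if its variables are forgotten. -/
def shape (c : PolyCode K A) : List (K × List ℕ) := c.map fun t => (t.1, t.2.map Prod.snd)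

/-- Renaming of variables. -/
def ren (f : A → A) (c : PolyCode K A) : PolyCode K A :=
  c.map fun t => (t.1, t.2.map fun v => (f v.1, v.2))

theorem toMono_map (f : A → A) (l : List (A × ℕ)) :
    toMono (l.map fun v => (f v.1, v.2)) = (toMono l).mapDomain f := by
  induction l with
  | nil => simp
  | cons v l ih => simp [ih, Finsupp.mapDomain_add, Finsupp.mapDomain_single]

theorem toPoly_ren (f : A → A) (c : PolyCode K A) : toPoly (ren f c) = rename f (toPoly c) := by
  induction c with
  | nil => simp [ren]
  | cons t c ih =>
    rw [ren] at ih
    simp [ren, ih, toMono_map, rename_monomial]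

theorem map_pair_iff (f : A → A) (l l' : List (A × ℕ)) :
    l' = l.map (fun v => (f v.1, v.2)) ↔
      l'.map Prod.snd = l.map Prod.snd ∧ l'.map Prod.fst = (l.map Prod.fst).map f := by
  constructor
  · rintro rfl; simp
  · rintro ⟨h₁, h₂⟩
    induction l generalizing l' with
    | nil => simpa using h₁
    | cons v l ih =>
      rcases l' with _ | ⟨w, l'⟩
      · simp at h₁
      · simp only [List.map_cons, List.cons.injEq] at h₁ h₂ ⊢
        exact ⟨Prod.ext h₂.1 h₁.1, ih l' h₁.2 h₂.2⟩

-- This reduces recognising a renamed copy to comparing shapes and testing a list of variables,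
-- which is what the decision procedure for local embeddings provides.
omit [Field K] in
theorem eq_ren_iff (f : A → A) (c c' : PolyCode K A) :
    c' = ren f c ↔ shape c' = shape c ∧ vars c' = (vars c).map f := by
  constructor
  · rintro rfl
    simp [ren, shape, vars, List.flatMap_map, List.map_flatMap, Function.comp_def]
  · rintro ⟨h₁, h₂⟩
    induction c generalizing c' with
    | nil => simpa [shape, ren] using h₁
    | cons t c ih =>
      rcases c' with _ | ⟨t', c'⟩
      · simp [shape] at h₁
      · simp only [shape, List.map_cons, List.cons.injEq, Prod.mk.injEq] at h₁
        simp only [vars, List.flatMap_cons, List.map_append] at h₂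
        -- Equal shapes force equal lengths, so the concatenated variable lists split at the same
        -- place.
        have hlen : (t'.2.map Prod.fst).length = ((t.2.map Prod.fst).map f).length := by
          simpa using congrArg List.length h₁.1.2
        obtain ⟨h₃, h₄⟩ := List.append_inj h₂ hlen
        rw [ih c' h₁.2 h₄, ren, ren, List.map_cons]
        congr 1
        exact Prod.ext h₁.1.1 ((map_pair_iff f _ _).2 ⟨h₁.1.2, h₃⟩)

end PolyCode

/-- All lists that arise from a given one by replacing each variable by an element of `s`. -/
def substitutions (s : List A) (l : List (A × ℕ)) : List (List (A × ℕ)) :=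
  l.foldr (fun v T => s.flatMap fun a => T.map fun l' => (a, v.2) :: l') [ [] ]

theorem mem_substitutions {s : List A} {l l' : List (A × ℕ)} :
    l' ∈ substitutions s l ↔ l'.map Prod.snd = l.map Prod.snd ∧ ∀ v ∈ l', v.1 ∈ s := by
  induction l generalizing l' with
  | nil =>
    simp only [substitutions, List.foldr_nil, List.mem_singleton, List.map_nil, List.map_eq_nil_iff]
    exact ⟨fun h => ⟨h, by simp [h]⟩, fun h => h.1⟩
  | cons v l ih =>
    have : substitutions s (v :: l) =
      s.flatMap fun a => (substitutions s l).map fun l' => (a, v.2) :: l' := rfl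
    rw [this]
    simp only [List.mem_flatMap, List.mem_map, ih]
    constructor
    · rintro ⟨a, ha, l'', ⟨h₁, h₂⟩, rfl⟩
      exact ⟨by simp [h₁], by simpa using ⟨ha, fun a b h => h₂ (a, b) h⟩⟩
    · rintro ⟨h₁, h₂⟩
      rcases l' with _ | ⟨w, l'⟩
      · simp at h₁
      · simp only [List.map_cons, List.cons.injEq] at h₁
        exact ⟨w.1, h₂ w (by simp), l', ⟨h₁.2, fun v hv => h₂ v (by simp [hv])⟩, by
          rw [← h₁.1]⟩

/-- Representations of polynomials with a distinguished monomial. -/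
abbrev MarkedCode (K A : Type*) : Type _ := List (A × ℕ) × PolyCode K A

namespace MarkedCode

/-- The polynomial and the distinguished monomial represented by a code. -/
noncomputable def toPair (x : MarkedCode K A) : (A →₀ ℕ) × MvPolynomial A K :=
  (toMono x.1, x.2.toPoly)

/-- The code that lists the distinguished monomial as an additional term. -/
def full (x : MarkedCode K A) : PolyCode K A := (1, x.1) :: x.2

/-- The polynomial is monic and the distinguished monomial is its leading one. -/
def IsMonic (r : A → A → Prop) (x : MarkedCode K A) : Prop :=
  coeff (toMono x.1) x.2.toPoly = 1 ∧ (∀ v ∈ x.1, v.2 ≠ 0) ∧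
    ∀ t ∈ x.2, toMono t.2 = toMono x.1 ∨ monoLt r (toMono t.2) (toMono x.1)

variable (L : Language) [L.Structure A]

/-- Listing the distinguished monomial as one more term ensures that a single embedding renames it
together with the polynomial; its coefficient 1 is only a placeholder. -/
theorem eq_embAct_of_full {x y : MarkedCode K A} {ι : A ↪[L] A}
    (h : y.full = PolyCode.ren ι x.full) : y.toPair = embAct L ι x.toPair := by
  simp only [full, PolyCode.ren, List.map_cons, List.cons.injEq, Prod.mk.injEq] at h
  refine Prod.ext ?_ ?_
  · simp [toPair, embAct, h.1.2, PolyCode.toMono_map]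
  · simp only [toPair, embAct, h.2, ← PolyCode.toPoly_ren]
    rfl

theorem exists_full_eq_ren (x : MarkedCode K A) (f : A → A) :
    ∃ y : MarkedCode K A, y.full = PolyCode.ren f x.full :=
  ⟨(x.1.map fun v => (f v.1, v.2), PolyCode.ren f x.2), rfl⟩

theorem exists_toPair_eq {r : A → A → Prop} {x : (A →₀ ℕ) × MvPolynomial A K}
    (hx : coeff x.1 x.2 = 1 ∧ ∀ n, coeff n x.2 ≠ 0 → n = x.1 ∨ monoLt r n x.1) :
    ∃ y : MarkedCode K A, y.toPair = x ∧ y.IsMonic r := by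
  obtain ⟨l, hl, hl'⟩ := exists_toMono_eq x.1
  obtain ⟨c, hc, hc'⟩ := PolyCode.exists_toPoly_eq x.2
  refine ⟨(l, c), Prod.ext hl hc, ?_, hl', fun t ht => ?_⟩
  · rw [hl, hc]; exact hx.1
  · rw [hl]; exact hx.2 _ (hc' t ht)

theorem isMonicSet_of_isMonic {r : A → A → Prop} {H : List (MarkedCode K A)}
    (h : ∀ x ∈ H, x.IsMonic r) : IsMonicSet r {z | ∃ x ∈ H, z = toPair x} := by
  rintro _ ⟨x, hx, rfl⟩
  refine ⟨(h x hx).1, fun n hn => ?_⟩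
  obtain ⟨t, ht, rfl⟩ := PolyCode.exists_of_coeff_ne_zero hn
  exact (h x hx).2.2 t ht

end MarkedCode

end Codes

/-! ### Decidability of operations on codes -/

section Decidability

variable {α A K : Type*} [Primcodable α] [Primcodable A] [Primcodable K] {r : A → A → Prop}

/-- Codes may repeat variables, so exponents have to be summed. -/
theorem computable_toMono_apply : Computable₂ fun (l : List (A × ℕ)) (a : A) => toMono l a := by
  classical
  have h : Computable fun q : List (A × ℕ) × A =>
      q.1.foldr (fun v s => (if v.1 = q.2 then v.2 else 0) + s) 0 := by
    refine Computable.list_foldr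
      (h := fun (q : List (A × ℕ) × A) (p : (A × ℕ) × ℕ) => (if p.1.1 = q.2 then p.1.2 else 0) + p.2)
      .fst (.const 0) ?_
    refine Primrec.nat_add.to_comp.comp (Computable.ite' (ComputablePred.eq ?_ ?_) ?_ (.const 0)) ?_
    · exact Computable.fst.comp (Computable.fst.comp .snd)
    · exact Computable.snd.comp .fst
    · exact Computable.snd.comp (Computable.fst.comp .snd)
    · exact Computable.snd.comp .snd
  refine h.of_eq fun q => ?_
  induction q.1 with
  | nil => simp
  | cons v l ih => simp [ih, Finsupp.single_apply]

theorem computable_toMono_comp {f : α → List (A × ℕ)} {g : α → A} (hf : Computable f)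
    (hg : Computable g) : Computable fun a => toMono (f a) (g a) :=
  computable_toMono_apply.comp hf hg

theorem computablePred_toMono_eq {f g : α → List (A × ℕ)} (hf : Computable f) (hg : Computable g) :
    ComputablePred fun a => toMono (f a) = toMono (g a) := by
  refine ComputablePred.of_eq (p := fun a => ∀ v ∈ f a ++ g a,
    toMono (f a) v.1 = toMono (g a) v.1) ?_ fun a => ⟨fun h => ?_, fun h v _ => by rw [h]⟩
  · refine ComputablePred.forall_mem (p := fun a v => toMono (f a) v.1 = toMono (g a) v.1)
      (Computable.list_append.comp hf hg) ?_
    exact .eq (computable_toMono_comp (hf.comp .fst) (Computable.fst.comp .snd))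
      (computable_toMono_comp (hg.comp .fst) (Computable.fst.comp .snd))
  · ext b
    by_contra hne
    have : toMono (f a) b ≠ 0 ∨ toMono (g a) b ≠ 0 := by
      by_contra! H; exact hne (H.1.trans H.2.symm)
    rcases this with h' | h' <;> obtain ⟨v, hv, rfl⟩ := exists_of_toMono_ne_zero h'
    · exact hne (h v (by simp [hv]))
    · exact hne (h v (by simp [hv]))

theorem computablePred_toMono_le {f g : α → List (A × ℕ)} (hf : Computable f) (hg : Computable g) :
    ComputablePred fun a => toMono (f a) ≤ toMono (g a) := by
  refine ComputablePred.of_eq (p := fun a => ∀ v ∈ f a,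
    toMono (f a) v.1 ≤ toMono (g a) v.1) ?_ fun a => ⟨fun h b => ?_, fun h v _ => h _⟩
  · refine ComputablePred.forall_mem (p := fun a v => toMono (f a) v.1 ≤ toMono (g a) v.1) hf ?_
    exact .nat_le (computable_toMono_comp (hf.comp .fst) (Computable.fst.comp .snd))
      (computable_toMono_comp (hg.comp .fst) (Computable.fst.comp .snd))
  · by_cases h' : toMono (f a) b = 0
    · simp [h']
    · obtain ⟨v, hv, rfl⟩ := exists_of_toMono_ne_zero h'
      exact h v hv

/-- Both monomials vanish off the listed variables, and the deciding variable occurs in the larger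
one; hence bounded quantifiers suffice. -/
theorem computablePred_monoLt (hr : ComputablePred fun p : A × A => r p.1 p.2)
    {f g : α → List (A × ℕ)} (hf : Computable f) (hg : Computable g) :
    ComputablePred fun a => monoLt r (toMono (f a)) (toMono (g a)) := by
  refine ComputablePred.of_eq (p := fun a => ∃ v ∈ g a,
    (∀ w ∈ f a ++ g a, r v.1 w.1 → toMono (f a) w.1 = toMono (g a) w.1) ∧
      toMono (f a) v.1 < toMono (g a) v.1) ?_ fun a => ⟨?_, ?_⟩
  · refine ComputablePred.exists_mem (p := fun a v =>
      (∀ w ∈ f a ++ g a, r v.1 w.1 → toMono (f a) w.1 = toMono (g a) w.1) ∧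
        toMono (f a) v.1 < toMono (g a) v.1) hg (.and ?_ ?_)
    · refine ComputablePred.forall_mem (f := fun q : α × A × ℕ => f q.1 ++ g q.1)
        (p := fun (q : α × A × ℕ) w => r q.2.1 w.1 → toMono (f q.1) w.1 = toMono (g q.1) w.1)
        (Computable.list_append.comp (hf.comp .fst) (hg.comp .fst)) (.imp ?_ ?_)
      · exact hr.comp ((Computable.fst.comp (Computable.snd.comp .fst)).pair
          (Computable.fst.comp .snd))
      · exact .eq (computable_toMono_comp (hf.comp (Computable.fst.comp .fst))
          (Computable.fst.comp .snd)) (computable_toMono_comp (hg.comp (Computable.fst.comp .fst))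
          (Computable.fst.comp .snd))
    · exact .nat_lt (computable_toMono_comp (hf.comp .fst) (Computable.fst.comp .snd))
        (computable_toMono_comp (hg.comp .fst) (Computable.fst.comp .snd))
  · rintro ⟨v, -, h, hlt⟩
    refine ⟨v.1, fun b hb => ?_, hlt⟩
    by_contra hne
    have : toMono (f a) b ≠ 0 ∨ toMono (g a) b ≠ 0 := by
      by_contra! H; exact hne (H.1.trans H.2.symm)
    rcases this with h' | h' <;> obtain ⟨w, hw, rfl⟩ := exists_of_toMono_ne_zero h'
    · exact hne (h w (by simp [hw]) hb)
    · exact hne (h w (by simp [hw]) hb)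
  · rintro ⟨b, h, hlt⟩
    obtain ⟨v, hv, rfl⟩ := exists_of_toMono_ne_zero (Nat.ne_zero_of_lt hlt)
    exact ⟨v, hv, fun w _ hw => h _ hw, hlt⟩

theorem computable_vars : Computable (PolyCode.vars : PolyCode K A → List A) := by
  refine Primrec.to_comp (Primrec.list_flatMap .id ?_)
  exact Primrec.list_map (Primrec.snd.comp .snd) (Primrec.fst.comp .snd)

theorem computable_shape : Computable (PolyCode.shape : PolyCode K A → List (K × List ℕ)) := by
  refine Primrec.to_comp (Primrec.list_map .id ?_)
  exact (Primrec.fst.comp .snd).pair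
    (Primrec.list_map (Primrec.snd.comp .snd) (Primrec.snd.comp .snd))

theorem computable_substitutions :
    Computable₂ (substitutions : List A → List (A × ℕ) → List (List (A × ℕ))) := by
  refine Primrec.to_comp (Primrec.list_foldr
    (h := fun (q : List A × List (A × ℕ)) (p : (A × ℕ) × List (List (A × ℕ))) =>
      q.1.flatMap fun a => p.2.map fun l' => (a, p.1.2) :: l') .snd (.const _) ?_)
  refine Primrec.list_flatMap (Primrec.fst.comp .fst) ?_
  refine Primrec.list_map (Primrec.snd.comp (Primrec.snd.comp .fst)) ?_
  refine Primrec.list_cons.comp (Primrec.pair ?_ ?_) .snd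
  · exact Primrec.snd.comp .fst
  · exact Primrec.snd.comp (Primrec.fst.comp (Primrec.snd.comp (Primrec.fst.comp .fst)))

theorem computable_map_fst : Computable (List.map Prod.fst : List (A × ℕ) → List A) :=
  Primrec.to_comp (Primrec.list_map .id (Primrec.fst.comp .snd))

variable [Field K]

theorem computable_coeff (hK : ComputableField K) {f : α → PolyCode K A}
    {g : α → List (A × ℕ)} (hf : Computable f) (hg : Computable g) :
    Computable fun a => coeff (toMono (g a)) (f a).toPoly := by
  classical
  have h : Computable fun a =>
      (f a).foldr (fun t s => (if toMono t.2 = toMono (g a) then t.1 else 0) + s) 0 := by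
    refine Computable.list_foldr (h := fun a (p : (K × List (A × ℕ)) × K) =>
        (if toMono p.1.2 = toMono (g a) then p.1.1 else 0) + p.2) hf (.const 0) ?_
    refine hK.add.comp (Computable.ite' (computablePred_toMono_eq ?_ ?_) ?_ (.const 0)) ?_
    · exact Computable.snd.comp (Computable.fst.comp .snd)
    · exact hg.comp .fst
    · exact Computable.fst.comp (Computable.fst.comp .snd)
    · exact Computable.snd.comp .snd
  refine h.of_eq fun a => ?_
  induction f a with
  | nil => simp
  | cons v l ih => simp [ih, coeff_monomial]

theorem computablePred_toPoly_eq (hK : ComputableField K) {f g : α → PolyCode K A}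
    (hf : Computable f) (hg : Computable g) :
    ComputablePred fun a => (f a).toPoly = (g a).toPoly := by
  refine ComputablePred.of_eq (p := fun a => ∀ t ∈ f a ++ g a,
    coeff (toMono t.2) (f a).toPoly = coeff (toMono t.2) (g a).toPoly) ?_
    fun a => ⟨fun h => ?_, fun h v _ => by rw [h]⟩
  · refine ComputablePred.forall_mem (p := fun a (t : K × List (A × ℕ)) =>
      coeff (toMono t.2) (f a).toPoly = coeff (toMono t.2) (g a).toPoly)
      (Computable.list_append.comp hf hg) ?_
    exact .eq (computable_coeff hK (hf.comp .fst) (Computable.snd.comp .snd))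
      (computable_coeff hK (hg.comp .fst) (Computable.snd.comp .snd))
  · ext n
    by_contra hne
    have : coeff n (f a).toPoly ≠ 0 ∨ coeff n (g a).toPoly ≠ 0 := by
      by_contra! H; exact hne (H.1.trans H.2.symm)
    rcases this with h' | h' <;> obtain ⟨t, ht, rfl⟩ := PolyCode.exists_of_coeff_ne_zero h'
    · exact hne (h t (by simp [ht]))
    · exact hne (h t (by simp [ht]))

theorem computable_mulTerm (hK : ComputableField K) :
    Computable₂ (PolyCode.mulTerm : K × List (A × ℕ) → PolyCode K A → PolyCode K A) := by
  refine Computable.list_map (g := fun (q : (K × List (A × ℕ)) × PolyCode K A)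
    (s : K × List (A × ℕ)) => (q.1.1 * s.1, q.1.2 ++ s.2)) .snd ?_
  exact (hK.mul.comp (Computable.fst.comp (Computable.fst.comp .fst))
      (Computable.fst.comp .snd)).pair
    (Computable.list_append.comp (Computable.snd.comp (Computable.fst.comp .fst))
      (Computable.snd.comp .snd))

theorem computable_full : Computable (MarkedCode.full : MarkedCode K A → PolyCode K A) :=
  Computable.list_cons.comp ((Computable.const 1).pair .fst) .snd

theorem computablePred_isMonic (hK : ComputableField K)
    (hr : ComputablePred fun p : A × A => r p.1 p.2) :
    ComputablePred fun x : MarkedCode K A => x.IsMonic r := by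
  refine .and (.eq (computable_coeff hK .snd .fst) (.const 1)) (.and ?_ ?_)
  · exact .forall_mem (p := fun (x : MarkedCode K A) v => v.2 ≠ 0) .fst
      (ComputablePred.not (.eq (Computable.snd.comp .snd) (.const 0)))
  · refine .forall_mem (p := fun (x : MarkedCode K A) (t : K × List (A × ℕ)) =>
      toMono t.2 = toMono x.1 ∨ monoLt r (toMono t.2) (toMono x.1)) .snd (.or ?_ ?_)
    · exact computablePred_toMono_eq (Computable.snd.comp .snd) (Computable.fst.comp .fst)
    · exact computablePred_monoLt hr (Computable.snd.comp .snd) (Computable.fst.comp .fst)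

variable {L : Language} [L.Structure A]

/-- By well quasi ordering, finitely many related pairs reach all others under embeddings; by
invariance they reach nothing else. So `r` is decided by finitely many tests for local embeddings.
-/
theorem computablePred_of_embedding_invariant (hws : OmegaWellStructured L A) (hA : ComputableDomain L A)
    (hirr : ∀ a, ¬r a a) (hι : ∀ (ι : A ↪[L] A) a b, r (ι a) (ι b) ↔ r a b) :
    ComputablePred fun p : A × A => r p.1 p.2 := by
  obtain ⟨F, hF, hF'⟩ := exists_list_pairs L hws r hirr
  refine ComputablePred.of_eq (p := fun p : A × A =>
    ∃ q ∈ F, [p.1, p.2] ∈ localEmbeddings L [q.1, q.2]) ?_ fun p => ⟨?_, ?_⟩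
  · refine .exists_mem (p := fun (p q : A × A) => [p.1, p.2] ∈ localEmbeddings L [q.1, q.2])
      (.const F) ?_
    have h2 : Computable fun p : A × A => [p.1, p.2] :=
      Computable.list_cons.comp .fst (Computable.list_cons.comp .snd (.const []))
    exact hA.decide_local.comp ((h2.comp .snd).pair (h2.comp .fst))
  · rintro ⟨q, hq, ι, h⟩
    simp only [List.map_cons, List.map_nil, List.cons.injEq, and_true] at h
    rw [h.1, h.2, hι]
    exact hF q hq
  · intro h
    obtain ⟨q, hq, ι, h₁, h₂⟩ := hF' _ _ h
    exact ⟨q, hq, ι, by simp [h₁, h₂]⟩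

/-- The set of polynomials with a distinguished monomial represented by a list of codes. -/
def pairSet (H : List (MarkedCode K A)) : Set ((A →₀ ℕ) × MvPolynomial A K) :=
  {z | ∃ x ∈ H, z = x.toPair}

-- A representation becomes a finite list of codes, each a term times a recognisable copy of an
-- element of `H`: an object that can be searched for.
omit [Primcodable A] [Primcodable K] in
theorem mem_combinations_orbit_iff {f : PolyCode K A} {H : List (MarkedCode K A)}
    {P : (A →₀ ℕ) → Prop} : f.toPoly ∈ combinations (orbit L (pairSet H)) P ↔
      ∃ T : List (PolyCode K A), (∀ p ∈ T, ∃ t : K × List (A × ℕ), ∃ x' : MarkedCode K A,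
        ∃ x ∈ H, (x'.full.shape = x.full.shape ∧
          x'.full.vars ∈ localEmbeddings L x.full.vars) ∧
        P (toMono (t.2 ++ x'.1)) ∧ p = PolyCode.mulTerm t x'.2) ∧
      f.toPoly = PolyCode.toPoly T.flatten := by
  constructor
  · intro hf
    generalize f.toPoly = q at hf
    induction hf using AddSubmonoid.closure_induction with
    | mem q hq =>
      obtain ⟨c, u, _, ⟨_, ⟨x, hx, rfl⟩, ι, rfl⟩, hP, rfl⟩ := hq
      obtain ⟨x', hx'⟩ := x.exists_full_eq_ren ι
      obtain ⟨l, rfl, -⟩ := exists_toMono_eq u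
      have hpair := MarkedCode.eq_embAct_of_full L hx'
      refine ⟨[PolyCode.mulTerm (c, l) x'.2], ?_, ?_⟩
      · simp only [List.mem_singleton, forall_eq]
        refine ⟨(c, l), x', x, hx, ?_, ?_, rfl⟩
        · obtain ⟨h₁, h₂⟩ := (PolyCode.eq_ren_iff _ _ _).1 hx'
          exact ⟨h₁, ι, h₂⟩
        · rw [← hpair] at hP
          simpa [MarkedCode.toPair] using hP
      · rw [← hpair]
        simp [MarkedCode.toPair]
    | zero => exact ⟨[], by simp, by simp⟩
    | add p q _ _ ihp ihq =>
      obtain ⟨T, hT, rfl⟩ := ihp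
      obtain ⟨T', hT', rfl⟩ := ihq
      refine ⟨T ++ T', fun p hp => ?_, by simp⟩
      rcases List.mem_append.1 hp with h | h
      exacts [hT p h, hT' p h]
  · rintro ⟨T, hT, h⟩
    rw [h]
    clear h
    induction T with
    | nil => simp
    | cons p T ih =>
      rw [List.flatten_cons, PolyCode.toPoly_append]
      refine add_mem ?_ (ih fun q hq => hT q (by simp [hq]))
      obtain ⟨t, x', x, hx, ⟨h₁, ι, h₂⟩, hP, rfl⟩ := hT p (by simp)
      rw [PolyCode.toPoly_mulTerm]
      have hpair := MarkedCode.eq_embAct_of_full L ((PolyCode.eq_ren_iff _ _ _).2 ⟨h₁, h₂⟩)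
      refine mem_combinations (x := x'.toPair) ⟨x.toPair, ⟨x, hx, rfl⟩, ι, hpair⟩ ?_
      simpa [MarkedCode.toPair] using hP

theorem sigmaOne_mem_combinations (hK : ComputableField K) (hA : ComputableDomain L A)
    {β : Type*} [Primcodable β] {B : β → (A →₀ ℕ) → Prop}
    (hB : ComputablePred fun q : β × List (A × ℕ) => B q.1 (toMono q.2)) :
    SigmaOne fun q : (PolyCode K A × List (MarkedCode K A)) × β =>
      q.1.1.toPoly ∈ combinations (orbit L (pairSet q.1.2)) (B q.2) := by
  refine SigmaOne.of_eq (SigmaOne.ex (β := List (PolyCode K A)) (.and ?_ ?_))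
    fun q => mem_combinations_orbit_iff.symm
  · refine .forall_mem (f := fun q : ((PolyCode K A × List (MarkedCode K A)) × β) ×
      List (PolyCode K A) => q.2) (p := fun q p =>
      ∃ t : K × List (A × ℕ), ∃ x' : MarkedCode K A,
        ∃ x ∈ q.1.1.2, (x'.full.shape = x.full.shape ∧
          x'.full.vars ∈ localEmbeddings L x.full.vars) ∧
        B q.1.2 (toMono (t.2 ++ x'.1)) ∧ p = PolyCode.mulTerm t x'.2) .snd ?_
    refine .ex (.ex (ComputablePred.sigmaOne ?_))
    refine .exists_mem (f := fun q : (((((PolyCode K A × List (MarkedCode K A)) × β) ×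
      List (PolyCode K A)) × PolyCode K A) × K × List (A × ℕ)) × MarkedCode K A =>
        q.1.1.1.1.1.2) (p := fun q (x : MarkedCode K A) => (q.2.full.shape = x.full.shape ∧
          q.2.full.vars ∈ localEmbeddings L x.full.vars) ∧
        B q.1.1.1.1.2 (toMono (q.1.2.2 ++ q.2.1)) ∧ q.1.1.2 = PolyCode.mulTerm q.1.2 q.2.2)
        ?_ ?_
    · exact Computable.snd.comp (Computable.fst.comp (Computable.fst.comp (Computable.fst.comp
        (Computable.fst.comp .fst))))
    · have hx : Computable fun q : ((((((PolyCode K A × List (MarkedCode K A)) × β) ×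
          List (PolyCode K A)) × PolyCode K A) × K × List (A × ℕ)) × MarkedCode K A) ×
          MarkedCode K A => q.2 := .snd
      have hx' : Computable fun q : ((((((PolyCode K A × List (MarkedCode K A)) × β) ×
          List (PolyCode K A)) × PolyCode K A) × K × List (A × ℕ)) × MarkedCode K A) ×
          MarkedCode K A => q.1.2 := Computable.snd.comp .fst
      have ht : Computable fun q : ((((((PolyCode K A × List (MarkedCode K A)) × β) ×
          List (PolyCode K A)) × PolyCode K A) × K × List (A × ℕ)) × MarkedCode K A) ×
          MarkedCode K A => q.1.1.2 := Computable.snd.comp (Computable.fst.comp .fst)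
      refine .and (.and ?_ ?_) (.and ?_ ?_)
      · exact .eq (computable_shape.comp (computable_full.comp hx'))
          (computable_shape.comp (computable_full.comp hx))
      · exact hA.decide_local.comp ((computable_vars.comp (computable_full.comp hx)).pair
          (computable_vars.comp (computable_full.comp hx')))
      · exact hB.comp ((Computable.snd.comp (Computable.fst.comp (Computable.fst.comp
          (Computable.fst.comp (Computable.fst.comp .fst))))).pair
            (Computable.list_append.comp (Computable.snd.comp ht) (Computable.fst.comp hx')))
      · exact .eq (Computable.snd.comp (Computable.fst.comp (Computable.fst.comp .fst)))
          ((computable_mulTerm hK).comp ht (Computable.snd.comp hx'))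
  · exact (computablePred_toPoly_eq hK (Computable.fst.comp (Computable.fst.comp .fst))
      (Computable.list_flatten (α := K × List (A × ℕ)).comp .snd)).sigmaOne

end Decidability

/-! ### Certificates for membership and non-membership -/

section Membership

variable {L : Language} {A K : Type*} [L.Structure A] [Field K] {r : A → A → Prop}

/-- The distinguished monomial is a dummy here: combinations without a bound ignore it. -/
theorem equivariantSpan_eq_orbitIdeal_pairSet (G : List (PolyCode K A)) :
    equivariantSpan L {g | ∃ c ∈ G, g = c.toPoly} =
      orbitIdeal L (pairSet (G.map fun c => (([] : List (A × ℕ)), c))) := by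
  rw [← equivariantSpan_eq_orbitIdeal]
  congr 1
  ext g
  simp [pairSet, MarkedCode.toPair, eq_comm]

/-- The `S`-polynomial of copies of `x` and `y`, whose variables are listed by `q`, is a combination
of elements of the orbits of `H` with terms below the least common multiple. -/
def SPolyReduces (L : Language) [L.Structure A] (r : A → A → Prop) (H : List (MarkedCode K A))
    (x y : MarkedCode K A) (q : List A × List A) : Prop :=
  ∃ (x' y' : MarkedCode K A) (u v : List (A × ℕ)),
    ((x'.full.shape = x.full.shape ∧ x'.full.vars = q.1) ∧
      y'.full.shape = y.full.shape ∧ y'.full.vars = q.2) ∧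
    (toMono (u ++ x'.1) = toMono (v ++ y'.1) ∧ ∀ a ∈ u, ∀ b ∈ v, a.1 ≠ b.1) ∧
    PolyCode.toPoly (PolyCode.mulTerm (1, u) x'.2 ++ PolyCode.mulTerm (-1, v) y'.2) ∈
      combinations (orbit L (pairSet H)) (monoLt r · (toMono (u ++ x'.1)))

/-- Buchberger's criterion, checked on a presentation of all pairs of local embeddings. -/
def IsGroebnerCode (L : Language) [L.Structure A] (r : A → A → Prop)
    (P : List A → List A → List (List A × List A)) (H : List (MarkedCode K A)) : Prop :=
  (∀ x ∈ H, x.IsMonic r) ∧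
    ∀ x ∈ H, ∀ y ∈ H, ∀ q ∈ P x.full.vars y.full.vars, SPolyReduces L r H x y q

variable {P : List A → List A → List (List A × List A)} {H : List (MarkedCode K A)}

theorem IsGroebnerCode.isBuchberger (hι : ∀ (ι : A ↪[L] A) a b, r (ι a) (ι b) ↔ r a b)
    (hP : ∀ B B', IsPresentation L B B' (P B B')) (h : IsGroebnerCode L r P H) :
    IsBuchberger r (orbit L (pairSet H)) := by
  refine isBuchberger_orbit hι ?_
  rintro _ ⟨_, ⟨x, hx, rfl⟩, ι, rfl⟩ _ ⟨_, ⟨y, hy, rfl⟩, ι', rfl⟩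
  have hmem : (x.full.vars.map ι, y.full.vars.map ι') ∈
      localEmbeddings L x.full.vars ×ˢ localEmbeddings L y.full.vars := ⟨⟨ι, rfl⟩, ⟨ι', rfl⟩⟩
  -- The presentation moves both copies back along the same `κ` to a pair from the finite list.
  rw [← (hP x.full.vars y.full.vars).2] at hmem
  obtain ⟨κ, q, hq, hκ⟩ := hmem
  obtain ⟨⟨π, hπ⟩, ⟨π', hπ'⟩⟩ := (hP _ _).1 q hq
  obtain ⟨x', y', u, v, ⟨⟨hx₁, hx₂⟩, hy₁, hy₂⟩, ⟨huv, hd⟩, hS⟩ := h.2 x hx y hy q hq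
  have hx' := MarkedCode.eq_embAct_of_full L
    ((PolyCode.eq_ren_iff π x.full x'.full).2 ⟨hx₁, hx₂.trans hπ⟩)
  have hy' := MarkedCode.eq_embAct_of_full L
    ((PolyCode.eq_ren_iff π' y.full y'.full).2 ⟨hy₁, hy₂.trans hπ'⟩)
  have hκx : embAct L ι x.toPair = embAct L κ x'.toPair := by
    obtain ⟨z, hz⟩ := x.exists_full_eq_ren ι
    rw [← MarkedCode.eq_embAct_of_full L hz]
    obtain ⟨h₁, h₂⟩ := (PolyCode.eq_ren_iff _ _ _).1 hz
    refine MarkedCode.eq_embAct_of_full L ((PolyCode.eq_ren_iff _ _ _).2 ⟨h₁.trans hx₁.symm, ?_⟩)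
    rw [h₂, hx₂]
    exact congrArg Prod.fst hκ
  have hκy : embAct L ι' y.toPair = embAct L κ y'.toPair := by
    obtain ⟨z, hz⟩ := y.exists_full_eq_ren ι'
    rw [← MarkedCode.eq_embAct_of_full L hz]
    obtain ⟨h₁, h₂⟩ := (PolyCode.eq_ren_iff _ _ _).1 hz
    refine MarkedCode.eq_embAct_of_full L ((PolyCode.eq_ren_iff _ _ _).2 ⟨h₁.trans hy₁.symm, ?_⟩)
    rw [h₂, hy₂]
    exact congrArg Prod.snd hκ
  refine ⟨x'.toPair, ⟨_, ⟨x, hx, rfl⟩, π, hx'⟩, y'.toPair, ⟨_, ⟨y, hy, rfl⟩, π', hy'⟩, κ,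
    hκx, hκy, toMono u, toMono v, by simpa [MarkedCode.toPair] using huv, fun a => ?_, ?_⟩
  · by_contra! hne
    obtain ⟨b, hb, rfl⟩ := exists_of_toMono_ne_zero hne.1
    obtain ⟨c, hc, hcb⟩ := exists_of_toMono_ne_zero hne.2
    exact hd b hb c hc hcb.symm
  · simpa [MarkedCode.toPair, sub_eq_add_neg] using hS

theorem isGroebnerCode_of_isBuchberger [IsWellOrder A r]
    (hP : ∀ B B', IsPresentation L B B' (P B B')) (hH : ∀ x ∈ H, x.IsMonic r)
    (hB : IsBuchberger r (orbit L (pairSet H))) : IsGroebnerCode L r P H := by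
  refine ⟨hH, fun x hx y hy q hq => ?_⟩
  obtain ⟨⟨π, hπ⟩, ⟨π', hπ'⟩⟩ := (hP _ _).1 q hq
  obtain ⟨x', hx'⟩ := x.exists_full_eq_ren π
  obtain ⟨y', hy'⟩ := y.exists_full_eq_ren π'
  obtain ⟨u, v, huv, hd, hS⟩ := hB x'.toPair
    ⟨_, ⟨x, hx, rfl⟩, π, MarkedCode.eq_embAct_of_full L hx'⟩ y'.toPair
    ⟨_, ⟨y, hy, rfl⟩, π', MarkedCode.eq_embAct_of_full L hy'⟩
  obtain ⟨l, rfl, hl⟩ := exists_toMono_eq u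
  obtain ⟨l', rfl, hl'⟩ := exists_toMono_eq v
  obtain ⟨hx₁, hx₂⟩ := (PolyCode.eq_ren_iff _ _ _).1 hx'
  obtain ⟨hy₁, hy₂⟩ := (PolyCode.eq_ren_iff _ _ _).1 hy'
  refine ⟨x', y', l, l', ⟨⟨hx₁, hx₂.trans hπ.symm⟩, hy₁, hy₂.trans hπ'.symm⟩,
    ⟨by simpa [MarkedCode.toPair] using huv, fun a ha b hb hab => ?_⟩,
    by simpa [MarkedCode.toPair, sub_eq_add_neg] using hS⟩
  -- Since the listed exponents are nonzero, a variable listed in both codes would have a positive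
  -- exponent in both cofactors.
  have h₁ := le_toMono ha
  have h₂ := le_toMono hb
  have h₃ := hl a ha
  have h₄ := hl' b hb
  rw [← hab] at h₂
  rcases hd a.1 with h | h <;> omega

theorem exists_isGroebnerCode [IsWellOrder A r] (hws : OmegaWellStructured L A)
    (hι : ∀ (ι : A ↪[L] A) a b, r (ι a) (ι b) ↔ r a b)
    (hP : ∀ B B', IsPresentation L B B' (P B B')) {I : Ideal (MvPolynomial A K)}
    (hI : IsEquivariantIdeal L I) : ∃ H : List (MarkedCode K A),
      IsGroebnerCode L r P H ∧ IsMonicSet r (orbit L (pairSet H)) ∧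
        IsGroebner r I (orbit L (pairSet H)) := by
  obtain ⟨H₀, hm, hg⟩ := exists_isGroebner hws hI (r := r)
  have : ∃ H : List (MarkedCode K A), (∀ x ∈ H, x.IsMonic r) ∧ H.map MarkedCode.toPair = H₀ := by
    clear hg
    induction H₀ with
    | nil => exact ⟨[], by simp, rfl⟩
    | cons z T ih =>
      obtain ⟨H, h₁, h₂⟩ := ih fun x hx => hm x (List.mem_cons_of_mem _ hx)
      obtain ⟨x, hx, hx'⟩ := MarkedCode.exists_toPair_eq (hm z List.mem_cons_self)
      exact ⟨x :: H, List.forall_mem_cons.2 ⟨hx', h₁⟩, by simp [hx, h₂]⟩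
  obtain ⟨H, h₁, h₂⟩ := this
  have hset : {x | x ∈ H₀} = pairSet H := by
    ext z
    simp [pairSet, ← h₂, eq_comm]
  rw [hset] at hm hg
  have hm' := hm.orbit hι
  exact ⟨H, isGroebnerCode_of_isBuchberger hP h₁ (hg.isBuchberger hm'), hm', hg⟩

/-- The monomial `l` is not divisible by monomials in the orbits of the distinguished monomials of `H`. -/
def IsIrreducibleCode (L : Language) [L.Structure A] (H : List (MarkedCode K A))
    (l : List (A × ℕ)) : Prop :=
  ∀ x ∈ H, ∀ l' ∈ substitutions (l.map Prod.fst) x.1,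
    ¬(l'.map Prod.fst ∈ localEmbeddings L (x.1.map Prod.fst) ∧ toMono l' ≤ toMono l)

/-- A divisor of `l` involves only variables of `l`, so finitely many substitutions need to be
tried. -/
theorem isIrreducibleCode_iff (hH : ∀ x ∈ H, x.IsMonic r) (l : List (A × ℕ)) :
    IsIrreducibleCode L H l ↔ ¬∃ z ∈ orbit L (pairSet H), z.1 ≤ toMono l := by
  constructor
  · rintro h ⟨_, ⟨_, ⟨x, hx, rfl⟩, ι, rfl⟩, hle⟩
    simp only [embAct, MarkedCode.toPair, ← PolyCode.toMono_map] at hle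
    refine h x hx (x.1.map fun v => (ι v.1, v.2)) (mem_substitutions.2 ⟨by simp, ?_⟩)
      ⟨⟨ι, by simp⟩, hle⟩
    intro w hw
    -- Without exponent 0, every listed variable of the renamed monomial really occurs in `l`; this
    -- is why `MarkedCode.IsMonic` excludes zero exponents.
    have hw2 : w.2 ≠ 0 := by
      obtain ⟨v, hv, rfl⟩ := List.mem_map.1 hw
      exact (hH x hx).2.1 v hv
    have h1 := (le_toMono hw).trans (hle w.1)
    obtain ⟨v, hv, hvw⟩ := exists_of_toMono_ne_zero (l := l) (a := w.1) (by omega)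
    exact List.mem_map.2 ⟨v, hv, hvw⟩
  · rintro h x hx l' hl' ⟨⟨ι, hι⟩, hle⟩
    refine h ⟨_, ⟨_, ⟨x, hx, rfl⟩, ι, rfl⟩, ?_⟩
    have := (PolyCode.map_pair_iff ι x.1 l').2 ⟨(mem_substitutions.1 hl').1, hι⟩
    simpa only [embAct, MarkedCode.toPair, ← PolyCode.toMono_map, ← this] using hle

/-- For existence, take a Gröbner basis of the ideal itself and a remainder `g` of `f`. For
soundness, `f` in the ideal would put `g` in the ideal of `H`, where Buchberger's criterion makes
its leading monomial divisible. -/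
theorem notMem_equivariantSpan_iff [IsWellOrder A r] (hws : OmegaWellStructured L A)
    (hι : ∀ (ι : A ↪[L] A) a b, r (ι a) (ι b) ↔ r a b)
    (hP : ∀ B B', IsPresentation L B B' (P B B')) (f : PolyCode K A) (G : List (PolyCode K A)) :
    f.toPoly ∉ equivariantSpan L {g | ∃ c ∈ G, g = c.toPoly} ↔
      ∃ (H : List (MarkedCode K A)) (g : PolyCode K A) (l : List (A × ℕ)),
        IsGroebnerCode L r P H ∧
        (∀ c ∈ G, c.toPoly ∈ combinations (orbit L (pairSet H)) fun _ => True) ∧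
        PolyCode.toPoly (g ++ PolyCode.mulTerm (-1, []) f) ∈
          combinations (orbit L (pairSet H)) (fun _ => True) ∧
        coeff (toMono l) g.toPoly ≠ 0 ∧
        (∀ t ∈ g, toMono t.2 = toMono l ∨ monoLt r (toMono t.2) (toMono l)) ∧
        IsIrreducibleCode L H l := by
  constructor
  · intro hf
    obtain ⟨H, hH, hm, hg⟩ := exists_isGroebnerCode (r := r) hws hι hP
      (isEquivariantIdeal_equivariantSpan {g : MvPolynomial A K | ∃ c ∈ G, g = c.toPoly})
    obtain ⟨p, hpf, m, hpm, hirr⟩ := hg.exists_remainder hm hf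
    obtain ⟨g, rfl, hg'⟩ := PolyCode.exists_toPoly_eq p
    obtain ⟨l, rfl, -⟩ := exists_toMono_eq m
    refine ⟨H, g, l, hH, fun c hc => ?_, ?_, hpm.1, fun t ht => hpm.2 _ (hg' t ht),
      (isIrreducibleCode_iff hH.1 l).2 hirr⟩
    · exact hg.mem_combinations hm (subset_equivariantSpan _ _ ⟨c, hc, rfl⟩)
    · have := hg.mem_combinations hm hpf
      simpa [sub_eq_add_neg] using this
  · rintro ⟨H, g, l, hH, hG, hgf, hl, hgl, hirr⟩ hf
    have hm := (MarkedCode.isMonicSet_of_isMonic hH.1).orbit hι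
    have hB := hH.isBuchberger hι hP
    have hle : equivariantSpan L {g | ∃ c ∈ G, g = c.toPoly} ≤ orbitIdeal L (pairSet H) := by
      refine equivariantSpan_le isEquivariantIdeal_orbitIdeal ?_
      rintro _ ⟨c, hc, rfl⟩
      exact mem_orbitIdeal.2 (hG c hc)
    have hg : g.toPoly ∈ combinations (orbit L (pairSet H)) fun _ => True := by
      have := add_mem hgf (mem_orbitIdeal.1 (hle hf))
      simpa using this
    refine (isIrreducibleCode_iff hH.1 l).1 hirr (hB.exists_le_top hm hg ⟨hl, fun n hn => ?_⟩)
    obtain ⟨t, ht, rfl⟩ := PolyCode.exists_of_coeff_ne_zero hn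
    exact hgl t ht

variable [Primcodable A] [Primcodable K]

theorem sigmaOne_mem_combinations_top (hK : ComputableField K) (hA : ComputableDomain L A)
    {α : Type*} [Primcodable α] {f : α → PolyCode K A} {g : α → List (MarkedCode K A)}
    (hf : Computable f) (hg : Computable g) :
    SigmaOne fun a => (f a).toPoly ∈ combinations (orbit L (pairSet (g a))) fun _ => True := by
  have h := sigmaOne_mem_combinations (L := L) (A := A) (B := fun (_ : Unit) _ => True) hK hA
    (.of_bool (.const true) fun _ => by simp)
  have hc : Computable fun a => ((f a, g a), ()) := (hf.pair hg).pair (.const ())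
  have h' := SigmaOne.comp h hc
  refine h'.of_eq fun a => ?_
  rfl

theorem sigmaOne_mem_combinations_lt (hK : ComputableField K) (hA : ComputableDomain L A)
    (hr : ComputablePred fun p : A × A => r p.1 p.2)
    {α : Type*} [Primcodable α] {f : α → PolyCode K A} {g : α → List (MarkedCode K A)}
    {l : α → List (A × ℕ)} (hf : Computable f) (hg : Computable g) (hl : Computable l) :
    SigmaOne fun a => (f a).toPoly ∈
      combinations (orbit L (pairSet (g a))) (monoLt r · (toMono (l a))) := by
  have h := sigmaOne_mem_combinations (L := L) (B := fun (l : List (A × ℕ)) m =>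
    monoLt r m (toMono l)) hK hA (computablePred_monoLt hr .snd .fst)
  have hc : Computable fun a => ((f a, g a), l a) := (hf.pair hg).pair hl
  have h' := SigmaOne.comp h hc
  refine h'.of_eq fun a => ?_
  rfl

theorem sigmaOne_sPolyReduces (hK : ComputableField K) (hA : ComputableDomain L A)
    (hr : ComputablePred fun p : A × A => r p.1 p.2)
    {α : Type*} [Primcodable α] {H : α → List (MarkedCode K A)} {x y : α → MarkedCode K A}
    {q : α → List A × List A} (hH : Computable H) (hx : Computable x) (hy : Computable y)
    (hq : Computable q) : SigmaOne fun a => SPolyReduces L r (H a) (x a) (y a) (q a) := by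
  refine .ex (.ex (.ex (.ex ?_)))
  have h₀ : Computable fun b : (((α × MarkedCode K A) × MarkedCode K A) × List (A × ℕ)) ×
      List (A × ℕ) => b.1.1.1.1 :=
    Computable.fst.comp (Computable.fst.comp (Computable.fst.comp .fst))
  have hx' : Computable fun b : (((α × MarkedCode K A) × MarkedCode K A) × List (A × ℕ)) ×
      List (A × ℕ) => b.1.1.1.2 :=
    Computable.snd.comp (Computable.fst.comp (Computable.fst.comp .fst))
  have hy' : Computable fun b : (((α × MarkedCode K A) × MarkedCode K A) × List (A × ℕ)) ×
      List (A × ℕ) => b.1.1.2 := Computable.snd.comp (Computable.fst.comp .fst)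
  have hu : Computable fun b : (((α × MarkedCode K A) × MarkedCode K A) × List (A × ℕ)) ×
      List (A × ℕ) => b.1.2 := Computable.snd.comp .fst
  have hv : Computable fun b : (((α × MarkedCode K A) × MarkedCode K A) × List (A × ℕ)) ×
      List (A × ℕ) => b.2 := .snd
  have hux := Computable.list_append.comp hu (Computable.fst.comp hx')
  refine .and (ComputablePred.sigmaOne ?_) (.and (ComputablePred.sigmaOne ?_) ?_)
  · refine .and (.and (.eq ?_ ?_) (.eq ?_ ?_)) (.and (.eq ?_ ?_) (.eq ?_ ?_))
    · exact computable_shape.comp (computable_full.comp hx')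
    · exact computable_shape.comp (computable_full.comp (hx.comp h₀))
    · exact computable_vars.comp (computable_full.comp hx')
    · exact Computable.fst.comp (hq.comp h₀)
    · exact computable_shape.comp (computable_full.comp hy')
    · exact computable_shape.comp (computable_full.comp (hy.comp h₀))
    · exact computable_vars.comp (computable_full.comp hy')
    · exact Computable.snd.comp (hq.comp h₀)
  · refine .and (computablePred_toMono_eq hux
      (Computable.list_append.comp hv (Computable.fst.comp hy'))) ?_
    refine .forall_mem (p := fun (b : (((α × MarkedCode K A) × MarkedCode K A) × List (A × ℕ)) ×
      List (A × ℕ)) a => ∀ c ∈ b.2, a.1 ≠ c.1) hu ?_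
    refine .forall_mem (f := fun b : ((((α × MarkedCode K A) × MarkedCode K A) × List (A × ℕ)) ×
      List (A × ℕ)) × A × ℕ => b.1.2) (p := fun b c => b.2.1 ≠ c.1) (hv.comp .fst) ?_
    exact ComputablePred.not (.eq (Computable.fst.comp (Computable.snd.comp .fst))
      (Computable.fst.comp .snd))
  · refine sigmaOne_mem_combinations_lt (α := (((α × MarkedCode K A) × MarkedCode K A) ×
      List (A × ℕ)) × List (A × ℕ)) hK hA hr (Computable.list_append.comp ?_ ?_)
      (hH.comp h₀) hux
    · exact (computable_mulTerm hK).comp ((Computable.const 1).pair hu) (Computable.snd.comp hx')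
    · exact (computable_mulTerm hK).comp ((Computable.const (-1)).pair hv)
        (Computable.snd.comp hy')

theorem sigmaOne_isGroebnerCode (hK : ComputableField K) (hA : ComputableDomain L A)
    (hr : ComputablePred fun p : A × A => r p.1 p.2) (hP : Computable₂ P) :
    SigmaOne fun H : List (MarkedCode K A) => IsGroebnerCode L r P H := by
  refine .and (ComputablePred.sigmaOne ?_) ?_
  · exact .forall_mem (p := fun (_ : List (MarkedCode K A)) x => x.IsMonic r) .id
      ((computablePred_isMonic hK hr).comp .snd)
  · refine .forall_mem (p := fun (H : List (MarkedCode K A)) x =>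
      ∀ y ∈ H, ∀ q ∈ P x.full.vars y.full.vars, SPolyReduces L r H x y q) .id ?_
    refine .forall_mem (f := fun a : List (MarkedCode K A) × MarkedCode K A => a.1)
      (p := fun a y => ∀ q ∈ P a.2.full.vars y.full.vars, SPolyReduces L r a.1 a.2 y q) .fst ?_
    refine .forall_mem (f := fun a : (List (MarkedCode K A) × MarkedCode K A) × MarkedCode K A =>
      P a.1.2.full.vars a.2.full.vars) (p := fun a q => SPolyReduces L r a.1.1 a.1.2 a.2 q) ?_ ?_
    · exact hP.comp (computable_vars.comp (computable_full.comp (Computable.snd.comp .fst)))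
        (computable_vars.comp (computable_full.comp .snd))
    · exact sigmaOne_sPolyReduces hK hA hr
        (Computable.fst.comp (Computable.fst.comp .fst))
        (Computable.snd.comp (Computable.fst.comp .fst)) (Computable.snd.comp .fst) .snd

omit [Field K] in
theorem computablePred_isIrreducibleCode (hA : ComputableDomain L A) :
    ComputablePred fun p : List (MarkedCode K A) × List (A × ℕ) =>
      IsIrreducibleCode L p.1 p.2 := by
  refine .forall_mem (p := fun (p : List (MarkedCode K A) × List (A × ℕ)) x =>
    ∀ l' ∈ substitutions (p.2.map Prod.fst) x.1,
      ¬(l'.map Prod.fst ∈ localEmbeddings L (x.1.map Prod.fst) ∧ toMono l' ≤ toMono p.2)) .fst ?_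
  refine .forall_mem (f := fun p : (List (MarkedCode K A) × List (A × ℕ)) × MarkedCode K A =>
    substitutions (p.1.2.map Prod.fst) p.2.1) (p := fun p l' =>
      ¬(l'.map Prod.fst ∈ localEmbeddings L (p.2.1.map Prod.fst) ∧ toMono l' ≤ toMono p.1.2)) ?_ ?_
  · exact computable_substitutions.comp
      (computable_map_fst.comp (Computable.snd.comp .fst)) (Computable.fst.comp .snd)
  · refine ComputablePred.not (.and ?_ ?_)
    · exact hA.decide_local.comp
        ((computable_map_fst.comp (Computable.fst.comp (Computable.snd.comp .fst))).pair
          (computable_map_fst.comp .snd))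
    · exact computablePred_toMono_le .snd (Computable.snd.comp (Computable.fst.comp .fst))

theorem sigmaOne_mem_equivariantSpan (hK : ComputableField K) (hA : ComputableDomain L A) :
    SigmaOne fun p : PolyCode K A × List (PolyCode K A) =>
      p.1.toPoly ∈ equivariantSpan L {g | ∃ c ∈ p.2, g = c.toPoly} := by
  have hG : Computable fun p : PolyCode K A × List (PolyCode K A) =>
      p.2.map fun c => (([] : List (A × ℕ)), c) :=
    Computable.list_map .snd ((Computable.const []).pair .snd)
  refine (sigmaOne_mem_combinations_top hK hA .fst hG).of_eq fun p => ?_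
  rw [equivariantSpan_eq_orbitIdeal_pairSet, mem_orbitIdeal]

theorem sigmaOne_notMem_equivariantSpan [IsWellOrder A r] (hK : ComputableField K)
    (hws : OmegaWellStructured L A) (hA : ComputableDomain L A)
    (hι : ∀ (ι : A ↪[L] A) a b, r (ι a) (ι b) ↔ r a b) :
    SigmaOne fun p : PolyCode K A × List (PolyCode K A) =>
      p.1.toPoly ∉ equivariantSpan L {g | ∃ c ∈ p.2, g = c.toPoly} := by
  have hr : ComputablePred fun p : A × A => r p.1 p.2 :=
    computablePred_of_embedding_invariant hws hA (fun a => irrefl_of r a) hι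
  obtain ⟨P, hPc, hP⟩ := hA.compute_presentation
  refine SigmaOne.of_eq (.ex (.ex (.ex ?_)))
    fun p => (notMem_equivariantSpan_iff (r := r) hws hι hP p.1 p.2).symm
  have hf : Computable fun b : (((PolyCode K A × List (PolyCode K A)) × List (MarkedCode K A)) ×
      PolyCode K A) × List (A × ℕ) => b.1.1.1.1 :=
    Computable.fst.comp (Computable.fst.comp (Computable.fst.comp .fst))
  have hG : Computable fun b : (((PolyCode K A × List (PolyCode K A)) × List (MarkedCode K A)) ×
      PolyCode K A) × List (A × ℕ) => b.1.1.1.2 :=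
    Computable.snd.comp (Computable.fst.comp (Computable.fst.comp .fst))
  have hH : Computable fun b : (((PolyCode K A × List (PolyCode K A)) × List (MarkedCode K A)) ×
      PolyCode K A) × List (A × ℕ) => b.1.1.2 := Computable.snd.comp (Computable.fst.comp .fst)
  have hg : Computable fun b : (((PolyCode K A × List (PolyCode K A)) × List (MarkedCode K A)) ×
      PolyCode K A) × List (A × ℕ) => b.1.2 := Computable.snd.comp .fst
  have hl : Computable fun b : (((PolyCode K A × List (PolyCode K A)) × List (MarkedCode K A)) ×
      PolyCode K A) × List (A × ℕ) => b.2 := .snd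
  refine .and ?_ (.and ?_ (.and ?_ (.and (ComputablePred.sigmaOne ?_)
    (.and (ComputablePred.sigmaOne ?_) (ComputablePred.sigmaOne ?_)))))
  · exact (sigmaOne_isGroebnerCode hK hA hr hPc).comp hH
  · exact .forall_mem (p := fun (b : (((PolyCode K A × List (PolyCode K A)) ×
        List (MarkedCode K A)) × PolyCode K A) × List (A × ℕ)) (c : PolyCode K A) =>
        c.toPoly ∈ combinations (orbit L (pairSet b.1.1.2)) fun _ => True) hG
      (sigmaOne_mem_combinations_top hK hA .snd (hH.comp .fst))
  · exact sigmaOne_mem_combinations_top hK hA (Computable.list_append.comp hg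
      ((computable_mulTerm hK).comp (.const (-1, [])) hf)) hH
  · exact ComputablePred.not (.eq (computable_coeff hK hg hl) (.const 0))
  · refine .forall_mem (p := fun (b : (((PolyCode K A × List (PolyCode K A)) ×
        List (MarkedCode K A)) × PolyCode K A) × List (A × ℕ)) (t : K × List (A × ℕ)) =>
        toMono t.2 = toMono b.2 ∨ monoLt r (toMono t.2) (toMono b.2)) hg (.or ?_ ?_)
    · exact computablePred_toMono_eq (Computable.snd.comp .snd) (hl.comp .fst)
    · exact computablePred_monoLt hr (Computable.snd.comp .snd) (hl.comp .fst)
  · exact (computablePred_isIrreducibleCode hA).comp (hH.pair hl)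

end Membership

theorem mainTheorem3 (L : FirstOrder.Language) [L.IsRelational] [Finite (Σ n, L.Relations n)]
    (A : Type*) [L.Structure A] [Primcodable A]
    (K : Type*) [Field K] [Primcodable K]
    (hK : ComputableField K)
    (hws : OmegaWellStructured L A)
    (hwo : DefinablyWellOrdered L A)
    (hA : ComputableDomain L A) :
    ComputablePred fun p : PolyCode K A × List (PolyCode K A) =>
      PolyCode.toPoly p.1 ∈ equivariantSpan L {g | ∃ c ∈ p.2, g = PolyCode.toPoly c} := by
  obtain ⟨φ, hφ, _⟩ := hwo
  have hι : ∀ (ι : A ↪[L] A) (a b : A), φ.Realize ![ι a, ι b] ↔ φ.Realize ![a, b] := by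
    intro ι a b
    have h := realize_isQF_comp_embedding ι hφ ![a, b] default
    have h₁ : ι ∘ ![a, b] = ![ι a, ι b] := by
      ext i; fin_cases i <;> rfl
    -- A formula has no free de Bruijn indices, so all assignments on `Fin 0` agree.
    rw [h₁, Subsingleton.elim (ι ∘ default) default] at h
    exact h
  exact (sigmaOne_mem_equivariantSpan hK hA).computablePred
    (sigmaOne_notMem_equivariantSpan (r := fun a b => φ.Realize ![a, b]) hK hws hA hι)
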